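/- Let $(V,g)$ be a real vector space of finite even dimension $\dim V\ge 4$ with a positive definite inner product $g$. Let $$\mathcal T=\{K\in \mathrm{End}\,V \mid K^2=-\mathbb 1,\ g(K\cdot,K\cdot)=g(\cdot,\cdot)\},$$ regarded as a submanifold of $\mathrm{End}\,V$, so that $T_K\mathcal T=\{A\in\mathfrak o(V,g)\mid AK+KA=0\}$, where $\mathfrak o(V,g)$ is the space of $g$-skew endomorphisms. Let $\mathfrak{gl}(\mathbb V)=\mathrm{End}\,V\times\mathcal T$ and $\mathfrak o(\mathbb V,g)=\mathfrak o(V,g)\times\mathcal T$ be the trivial bundles over $\mathcal T$, and let $\phi$ be the tautological section $\phi|_K=K$. Write $[A,B]=AB-BA$ and $\{A,B\}=AB+BA$; write $\Gamma(\cdot)$ for smooth sections and $df_X$ for the derivative of $f$ along $X$. All conditions below are understood at each point $K\in\mathcal T$. A *skew algebroid* $(E,[\cdot,\cdot],\psi)$ on $\mathcal T$ is a smooth vector bundle $E\to\mathcal T$ with a skew-symmetric $\mathbb R$-bilinear bracket on $\Gamma(E)$ and a smooth bundle map $\psi:E\to T\mathcal T$ such that $\psi([A,B])=[\psi(A),\psi(B)]_{Lie}$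 and $[A,fB]=f[A,B]+\psi(A)[f]\,B$ for all $A,B\in\Gamma(E)$ and $f\in C^\infty(\mathcal T)$. Fix $J\in\mathcal T$, let $S\in\{\mathbb 1,\ J+\phi,\ J-\phi,\ [J,\phi]\}$, and let $E$ be one of $$\mathfrak o(\mathbb V,g),\quad \mathfrak o_{\{\phi\}}(\mathbb V)=\{A\in \mathfrak o(\mathbb V,g)\mid \{A,\phi\}=0\},\quad \mathfrak u(\mathbb V,J)=\{A\in \mathfrak o(\mathbb V,g)\mid [A,J]=0\},\quad \mathfrak u(\mathbb V,\phi)=\{A\in \mathfrak o(\mathbb V,g)\mid [A,\phi]=0\}.$$ For $\gamma\in\{\pm J,\pm\phi\}$ let $\tilde\gamma$ be the unique element of $\{\pm J,\pm\phi\}$ with $\gamma S=S\tilde\gamma$; it is also the unique one with $S\gamma=\tilde\gamma S$. If $E=\{A\in\mathfrak o(\mathbb V,g)\mid \gamma A=A\delta\}$ with $\gamma\in\{\pm J,\pm\phi\}$ and $\delta\in\{\gamma,-\gamma\}$, put $E^S=\{B\in\mathfrak o(\mathbb V,g)\mid\tilde\gamma B=B\tilde\delta\}$; if $E=\mathfrak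 o(\mathbb V,g)$, put $E^S=\mathfrak o(\mathbb V,g)$. **Theorem.** Let $k\geq 0$, let $a_0,\dots,a_k\in C^\infty(\mathcal T)$, let $$Q=a_k\{J,\phi\}^k+\dots+a_1\{J,\phi\}+a_0\mathbb 1,\qquad F=QS,$$ and suppose that $d(a_i)_{[SCS,\phi]}=0$ for all $i$ and all $C\in\Gamma(E^S)$. Let $\psi:E^S\to T\mathcal T$, $\psi(A)=[FAF,\phi]$. Then there is a skew bracket $[\cdot,\cdot]_F$ on $\Gamma(E^S)$ such that $(E^S,[\cdot,\cdot]_F,\psi)$ is a skew algebroid on $\mathcal T$. -/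

import Mathlib

open scoped ContDiff Topology InnerProductSpace

noncomputable section

namespace Twistor

variable (V : Type*) [NormedAddCommGroup V] [InnerProductSpace ℝ V]

/-- The twistor space of `V`: the orthogonal complex structures on `V`, as a subset of `End V`. -/
def twistorSet : Set (V →L[ℝ] V) :=
  {K | K * K = -1 ∧ ∀ x y : V, ⟪K x, K y⟫_ℝ = ⟪x, y⟫_ℝ}

/-- The twistor space as a type. -/
abbrev Tw : Type _ := ↥(twistorSet V)

/-- The Lie algebra `𝔬(V,g)` of skew endomorphisms. -/
def skewEnd : Submodule ℝ (V →L[ℝ] V) where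
  carrier := {A | ∀ x y : V, ⟪A x, y⟫_ℝ = -⟪x, A y⟫_ℝ}
  add_mem' := by
    intro A B hA hB x y
    simp only [Set.mem_ofPred_eq] at hA hB
    simp only [add_apply, inner_add_left, inner_add_right, hA x y, hB x y]
    ring
  zero_mem' := by intro x y; simp
  smul_mem' := by
    intro c A hA x y
    simp only [Set.mem_ofPred_eq] at hA
    simp only [smul_apply, inner_smul_left, inner_smul_right, hA x y]
    simp

variable {V}

/-- The tangent space `T_K 𝒯 = {A ∈ 𝔬(V,g) | AK + KA = 0}`, as a subspace of `End V`. -/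
def tangent (K : Tw V) : Submodule ℝ (V →L[ℝ] V) where
  carrier := {A | A ∈ skewEnd V ∧ A * K.1 + K.1 * A = 0}
  add_mem' := by
    rintro A B ⟨hA, hA'⟩ ⟨hB, hB'⟩
    refine ⟨add_mem hA hB, ?_⟩
    rw [add_mul, mul_add, add_add_add_comm, hA', hB', add_zero]
  zero_mem' := ⟨zero_mem _, by simp⟩
  smul_mem' := by
    rintro c A ⟨hA, hA'⟩
    refine ⟨Submodule.smul_mem _ c hA, ?_⟩
    rw [smul_mul_assoc, mul_smul_comm, ← smul_add, hA', smul_zero]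

section Calculus

variable {F : Type*} [NormedAddCommGroup F] [NormedSpace ℝ F]

/-- `f` is smooth near `K` on the submanifold `𝒯 ⊆ End V`: it is the restriction of a smooth map
defined on an open neighbourhood of `K` in `End V`. -/
def SmoothNear (f : Tw V → F) (K : Tw V) : Prop :=
  ∃ (U : Set (V →L[ℝ] V)) (g : (V →L[ℝ] V) → F), IsOpen U ∧ K.1 ∈ U ∧ ContDiffOn ℝ ∞ g U ∧
    ∀ L : Tw V, L.1 ∈ U → g L.1 = f L

/-- Smooth maps on `𝒯` with values in a normed space. -/
def IsSmooth (f : Tw V → F) : Prop := ∀ K, SmoothNear f K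

/-- The extension by zero of a map on `𝒯` to `End V`; only its values on `𝒯` are ever used. -/
def ext (f : Tw V → F) : (V →L[ℝ] V) → F := Function.extend Subtype.val f 0

/-- `df_X` at `K`, for `X ∈ T_K 𝒯`: the derivative within `𝒯` of `f`, applied to `X`.
(A derivative within `𝒯` is determined exactly on the tangent vectors to `𝒯`.) -/
def dd (f : Tw V → F) (K : Tw V) (X : V →L[ℝ] V) : F :=
  fderivWithin ℝ (ext f) (twistorSet V) K.1 X

theorem IsSmooth.add {f g : Tw V → F} (hf : IsSmooth f) (hg : IsSmooth g) :
    IsSmooth (f + g) := by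
  intro K
  obtain ⟨U, f', hU, hKU, hf', hff⟩ := hf K
  obtain ⟨W, g', hW, hKW, hg', hgg⟩ := hg K
  refine ⟨U ∩ W, fun x => f' x + g' x, hU.inter hW, ⟨hKU, hKW⟩,
    (hf'.mono Set.inter_subset_left).add (hg'.mono Set.inter_subset_right), ?_⟩
  intro L hL
  simp [hff L hL.1, hgg L hL.2]

theorem IsSmooth.smul {a : Tw V → ℝ} {f : Tw V → F} (ha : IsSmooth a) (hf : IsSmooth f) :
    IsSmooth (fun K => a K • f K) := by
  intro K
  obtain ⟨U, a', hU, hKU, ha', haa⟩ := ha K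
  obtain ⟨W, f', hW, hKW, hf', hff⟩ := hf K
  refine ⟨U ∩ W, fun x => a' x • f' x, hU.inter hW, ⟨hKU, hKW⟩,
    (ha'.mono Set.inter_subset_left).smul (hf'.mono Set.inter_subset_right), ?_⟩
  intro L hL
  simp [haa L hL.1, hff L hL.2]

theorem isSmooth_const (c : F) : IsSmooth (fun _ : Tw V => c) := fun _ =>
  ⟨Set.univ, fun _ => c, isOpen_univ, trivial, contDiffOn_const, fun _ _ => rfl⟩

end Calculus

/-- The family of subspaces `E K ⊆ End V` is a smooth vector subbundle of the trivial bundle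
`𝔤𝔩(𝕍) = End V × 𝒯`: near each point it has a smooth frame. -/
def IsSubbundle (E : Tw V → Submodule ℝ (V →L[ℝ] V)) : Prop :=
  ∀ K₀ : Tw V, ∃ (U : Set (Tw V)) (r : ℕ) (s : Fin r → Tw V → (V →L[ℝ] V)),
    IsOpen U ∧ K₀ ∈ U ∧ (∀ i, ∀ K ∈ U, SmoothNear (s i) K) ∧
    ∀ K ∈ U, LinearIndependent ℝ (fun i => s i K) ∧
      Submodule.span ℝ (Set.range fun i => s i K) = E K

/-- `Γ(E)`: the smooth sections of `E`. -/
def Gam (E : Tw V → Submodule ℝ (V →L[ℝ] V)) : Submodule ℝ (Tw V → (V →L[ℝ] V)) where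
  carrier := {A | IsSmooth A ∧ ∀ K, A K ∈ E K}
  add_mem' := by
    rintro A B ⟨hA, hA'⟩ ⟨hB, hB'⟩
    exact ⟨hA.add hB, fun K => add_mem (hA' K) (hB' K)⟩
  zero_mem' := ⟨isSmooth_const 0, fun K => zero_mem _⟩
  smul_mem' := by
    rintro c A ⟨hA, hA'⟩
    exact ⟨(isSmooth_const c).smul hA, fun K => Submodule.smul_mem _ c (hA' K)⟩

/-- The product `f A` of a section `A` by a smooth function `f`. -/
def mulSec {E : Tw V → Submodule ℝ (V →L[ℝ] V)} (f : Tw V → ℝ) (hf : IsSmooth f) (A : Gam E) :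
    Gam E :=
  ⟨fun K => f K • A.1 K, hf.smul A.2.1, fun K => Submodule.smul_mem _ _ (A.2.2 K)⟩

/-- The image `ψ(A)` of a section under a fibrewise map. -/
def pushSec (ψ : Tw V → (V →L[ℝ] V) →ₗ[ℝ] (V →L[ℝ] V)) (A : Tw V → (V →L[ℝ] V)) :
    Tw V → (V →L[ℝ] V) :=
  fun K => ψ K (A K)

/-- The Lie bracket of two vector fields on `𝒯`. -/
def lieBr (X Y : Tw V → (V →L[ℝ] V)) : Tw V → (V →L[ℝ] V) :=
  fun K => VectorField.lieBracketWithin ℝ (ext X) (ext Y) (twistorSet V) K.1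

/-- `(E, br, ψ)` is a skew algebroid on `𝒯`. Only the values of `ψ K` on `E K` matter. -/
structure IsSkewAlgebroid (E : Tw V → Submodule ℝ (V →L[ℝ] V))
    (br : Gam E →ₗ[ℝ] Gam E →ₗ[ℝ] Gam E)
    (ψ : Tw V → (V →L[ℝ] V) →ₗ[ℝ] (V →L[ℝ] V)) : Prop where
  /-- `E` is a smooth vector bundle. -/
  subbundle : IsSubbundle E
  /-- `ψ` maps `E` to the tangent bundle of `𝒯`. -/
  anchor_mem : ∀ K, ∀ A ∈ E K, ψ K A ∈ tangent K
  /-- `ψ` is a smooth bundle map. -/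
  anchor_smooth : ∀ A : Gam E, IsSmooth (pushSec ψ A.1)
  skew : ∀ A B : Gam E, br A B = -br B A
  anchor_bracket : ∀ A B : Gam E,
    pushSec ψ (br A B).1 = lieBr (pushSec ψ A.1) (pushSec ψ B.1)
  leibniz : ∀ (A B : Gam E) (f : Tw V → ℝ) (hf : IsSmooth f) (K : Tw V),
    (br A (mulSec f hf B)).1 K =
      f K • (br A B).1 K + dd f K (ψ K (A.1 K)) • B.1 K

/-- The four choices `𝟙`, `J + φ`, `J - φ`, `[J, φ]` for `S`. -/
inductive SType
  | one | plus | minus | comm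

/-- The section `S` of `𝔤𝔩(𝕍)`; here `φ` is the tautological section, `φ|_K = K`. -/
def SType.sec (S : SType) (J : Tw V) (K : Tw V) : V →L[ℝ] V :=
  match S with
  | .one => 1
  | .plus => J.1 + K.1
  | .minus => J.1 - K.1
  | .comm => J.1 * K.1 - K.1 * J.1

/-- The set `{±J, ±φ}`. -/
inductive Gen
  | posJ | negJ | posPhi | negPhi

/-- An element of `{±J, ±φ}` as a section of `𝔤𝔩(𝕍)`. -/
def Gen.sec (γ : Gen) (J : Tw V) (K : Tw V) : V →L[ℝ] V :=
  match γ with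
  | .posJ => J.1
  | .negJ => -J.1
  | .posPhi => K.1
  | .negPhi => -K.1

/-- `γ ↦ γ̃`, where `γ̃` is the unique element of `{±J, ±φ}` with `γ S = S γ̃`, equivalently with
`S γ = γ̃ S`; see `Gen.tilde_left_iff` and `Gen.tilde_right_iff`. -/
def Gen.tilde : SType → Gen → Gen
  | .one, γ => γ
  | .plus, .posJ => .posPhi
  | .plus, .negJ => .negPhi
  | .plus, .posPhi => .posJ
  | .plus, .negPhi => .negJ
  | .minus, .posJ => .negPhi
  | .minus, .negJ => .posPhi
  | .minus, .posPhi => .negJ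
  | .minus, .negPhi => .posJ
  | .comm, .posJ => .negJ
  | .comm, .negJ => .posJ
  | .comm, .posPhi => .negPhi
  | .comm, .negPhi => .posPhi

theorem sq_apply (K : Tw V) (x : V) : K.1 (K.1 x) = -x := by
  simpa using congrArg (fun A : V →L[ℝ] V => A x) K.2.1

theorem Gen.mul_S (S : SType) (γ : Gen) (J K : Tw V) :
    γ.sec J K * S.sec J K = S.sec J K * (γ.tilde S).sec J K := by
  ext x
  cases S <;> cases γ <;> simp [Gen.sec, SType.sec, Gen.tilde, sq_apply] <;> abel

theorem Gen.S_mul (S : SType) (γ : Gen) (J K : Tw V) :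
    S.sec J K * γ.sec J K = (γ.tilde S).sec J K * S.sec J K := by
  ext x
  cases S <;> cases γ <;> simp [Gen.sec, SType.sec, Gen.tilde, sq_apply] <;> abel

theorem inner_J (J : Tw V) (x y : V) : ⟪J.1 x, y⟫_ℝ = -⟪x, J.1 y⟫_ℝ := by
  rw [← J.2.2 x (J.1 y), sq_apply, inner_neg_right, neg_neg]

theorem inner_J_self (J : Tw V) (x : V) : ⟪x, J.1 x⟫_ℝ = 0 := by
  have h := inner_J J x x
  rw [real_inner_comm] at h
  linarith

theorem norm_J (J : Tw V) (x : V) : ‖J.1 x‖ = ‖x‖ := by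
  have h := J.2.2 x x
  rw [real_inner_self_eq_norm_sq, real_inner_self_eq_norm_sq] at h
  exact (sq_eq_sq₀ (norm_nonneg _) (norm_nonneg _)).1 h

/-- In dimension at least four there is a `K` that anticommutes with `J` on a nonzero vector. -/
theorem exists_anticomm [FiniteDimensional ℝ V] (h4 : 4 ≤ Module.finrank ℝ V) (J : Tw V) :
    ∃ (K : Tw V) (e : V), e ≠ 0 ∧ K.1 (J.1 e) = -J.1 (K.1 e) := by
  classical
  have : Nontrivial V := Module.nontrivial_of_finrank_pos (R := ℝ) (by omega)
  obtain ⟨e, he⟩ := exists_norm_eq V (zero_le_one' ℝ)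
  let P : Submodule ℝ V := Submodule.span ℝ (({e, J.1 e} : Finset V) : Set V)
  have hP : Module.finrank ℝ P ≤ 2 :=
    (finrank_span_finset_le_card ({e, J.1 e} : Finset V)).trans Finset.card_le_two
  have hP' : 0 < Module.finrank ℝ Pᗮ := by
    have := P.finrank_add_finrank_orthogonal
    omega
  have : Nontrivial Pᗮ := Module.nontrivial_of_finrank_pos hP'
  obtain ⟨⟨f, hfP⟩, hf⟩ := exists_norm_eq Pᗮ (zero_le_one' ℝ)
  have hf : ‖f‖ = 1 := hf
  have hee : ⟪e, e⟫_ℝ = 1 := by rw [real_inner_self_eq_norm_sq, he]; norm_num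
  have hff : ⟪f, f⟫_ℝ = 1 := by rw [real_inner_self_eq_norm_sq, hf]; norm_num
  have hef : ⟪e, f⟫_ℝ = 0 :=
    (Submodule.mem_orthogonal P f).1 hfP e (Submodule.subset_span (by simp))
  have hJef : ⟪J.1 e, f⟫_ℝ = 0 :=
    (Submodule.mem_orthogonal P f).1 hfP (J.1 e) (Submodule.subset_span (by simp))
  have heJf : ⟪e, J.1 f⟫_ℝ = 0 := by
    have := inner_J J e f
    linarith
  have hfe : ⟪f, e⟫_ℝ = 0 := by rw [real_inner_comm]; exact hef
  have hfJe : ⟪f, J.1 e⟫_ℝ = 0 := by rw [real_inner_comm]; exact hJef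
  have hJfe : ⟪J.1 f, e⟫_ℝ = 0 := by rw [real_inner_comm]; exact heJf
  have heJe := inner_J_self J e
  have hfJf := inner_J_self J f
  have hJee : ⟪J.1 e, e⟫_ℝ = 0 := by rw [real_inner_comm]; exact heJe
  have hJff : ⟪J.1 f, f⟫_ℝ = 0 := by rw [real_inner_comm]; exact hfJf
  let ι : V → (V →L[ℝ] ℝ) := fun v => innerSL ℝ v
  let K : V →L[ℝ] V := J.1
    - ((ι e).smulRight (J.1 e) - (ι (J.1 e)).smulRight e
      + (ι f).smulRight (J.1 f) - (ι (J.1 f)).smulRight f)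
    + ((ι e).smulRight f - (ι f).smulRight e
      - (ι (J.1 e)).smulRight (J.1 f) + (ι (J.1 f)).smulRight (J.1 e))
  have hK : ∀ x, K x = J.1 x
      - (⟪e, x⟫_ℝ • J.1 e - ⟪J.1 e, x⟫_ℝ • e + ⟪f, x⟫_ℝ • J.1 f - ⟪J.1 f, x⟫_ℝ • f)
      + (⟪e, x⟫_ℝ • f - ⟪f, x⟫_ℝ • e - ⟪J.1 e, x⟫_ℝ • J.1 f + ⟪J.1 f, x⟫_ℝ • J.1 e) := by
    intro x
    simp [K, ι]
  have hKe : K e = f := by simp [hK, he, hfe, hJee, hJfe]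
  have hKf : K f = -e := by simp [hK, hf, hef, hJef, hJff]
  have hKJe : K (J.1 e) = -J.1 f := by
    simp [hK, heJe, hfJe, J.2.2, norm_J, he, hfe, sq_apply]
  have hKJf : K (J.1 f) = J.1 e := by
    simp [hK, heJf, hfJf, J.2.2, norm_J, hf, hef, sq_apply]
  have hsq : K * K = -1 := by
    ext x
    rw [mul_apply_eq_comp]
    conv_lhs => rw [hK x]
    simp only [map_add, map_sub, map_smul, hKe, hKf, hKJe, hKJf]
    rw [hK (J.1 x)]
    have h1 : ⟪e, J.1 x⟫_ℝ = -⟪J.1 e, x⟫_ℝ := by rw [inner_J, neg_neg]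
    have h2 : ⟪f, J.1 x⟫_ℝ = -⟪J.1 f, x⟫_ℝ := by rw [inner_J, neg_neg]
    simp only [sq_apply, J.2.2, h1, h2, neg_apply,
      one_apply_eq_self]
    module
  have hskew : ∀ x y, ⟪K x, y⟫_ℝ = -⟪x, K y⟫_ℝ := by
    intro x y
    simp only [hK, inner_add_left, inner_add_right, inner_sub_left, inner_sub_right,
      real_inner_smul_left, real_inner_smul_right, inner_J J x y]
    simp only [real_inner_comm x]
    ring
  refine ⟨⟨K, hsq, ?_⟩, e, ?_, ?_⟩
  · intro x y
    have h : K (K y) = -y := by simpa using congrArg (fun A : V →L[ℝ] V => A y) hsq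
    rw [hskew, h, inner_neg_right, neg_neg]
  · rintro rfl
    simp at he
  · change K (J.1 e) = -J.1 (K e)
    rw [hKJe, hKe]

theorem anticomm_mul {J K : Tw V} {v : V} (hv : K.1 (J.1 v) = -J.1 (K.1 v)) :
    K.1 (J.1 (K.1 v)) = J.1 v := by
  rw [← neg_eq_iff_eq_neg.2 hv, map_neg, sq_apply, neg_neg]

theorem anticomm_gen {J K : Tw V} {v : V} (hv : K.1 (J.1 v) = -J.1 (K.1 v)) (γ : Gen) :
    K.1 (J.1 (γ.sec J K v)) = -J.1 (K.1 (γ.sec J K v)) := by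
  cases γ <;> simp [Gen.sec, hv, anticomm_mul hv, sq_apply]

theorem anticomm_S {J K : Tw V} {v : V} (hv : K.1 (J.1 v) = -J.1 (K.1 v)) (S : SType) :
    K.1 (J.1 (S.sec J K v)) = -J.1 (K.1 (S.sec J K v)) := by
  cases S <;> simp [SType.sec, hv, anticomm_mul hv, sq_apply] <;> abel

theorem S_S_apply {J K : Tw V} {v : V} (hv : K.1 (J.1 v) = -J.1 (K.1 v)) (S : SType) :
    ∃ c : ℝ, c ≠ 0 ∧ ∀ γ : Gen, S.sec J K (S.sec J K (γ.sec J K v)) = c • γ.sec J K v := by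
  have key : ∃ c : ℝ, c ≠ 0 ∧ ∀ w, K.1 (J.1 w) = -J.1 (K.1 w) →
      S.sec J K (S.sec J K w) = c • w := by
    cases S
    · exact ⟨1, one_ne_zero, fun w _ => by simp [SType.sec]⟩
    · refine ⟨-2, by norm_num, fun w hw => ?_⟩
      simp [SType.sec, hw, sq_apply]; module
    · refine ⟨-2, by norm_num, fun w hw => ?_⟩
      simp [SType.sec, hw, sq_apply]; module
    · refine ⟨-4, by norm_num, fun w hw => ?_⟩
      simp [SType.sec, hw, anticomm_mul hw, sq_apply]; module
  obtain ⟨c, hc, h⟩ := key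
  exact ⟨c, hc, fun γ => h _ (anticomm_gen hv γ)⟩

theorem gen_inj {J K : Tw V} {v : V} (hv0 : v ≠ 0) (hv : K.1 (J.1 v) = -J.1 (K.1 v))
    {γ γ' : Gen} (h : γ.sec J K v = γ'.sec J K v) : γ = γ' := by
  have hne : ⟪v, v⟫_ℝ ≠ 0 := inner_self_ne_zero.2 hv0
  have hJK : ⟪J.1 v, K.1 v⟫_ℝ = 0 := by
    have h1 := inner_J J v (K.1 v)
    have h2 := inner_J K v (J.1 v)
    rw [hv, inner_neg_right, neg_neg, real_inner_comm] at h2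
    linarith
  have hKJ : ⟪K.1 v, J.1 v⟫_ℝ = 0 := by rw [real_inner_comm]; exact hJK
  have hJ := congrArg (fun w => ⟪J.1 v, w⟫_ℝ) h
  have hK := congrArg (fun w => ⟪K.1 v, w⟫_ℝ) h
  cases γ <;> cases γ' <;> first
    | rfl
    | (exfalso
       simp only [Gen.sec, neg_apply, inner_neg_right, J.2.2, K.2.2, hJK,
         hKJ] at hJ hK
       apply hne
       linarith)

/-- `γ̃` is the unique element of `{±J, ±φ}` with `γ S = S γ̃`. -/
theorem Gen.tilde_left_iff [FiniteDimensional ℝ V] (h4 : 4 ≤ Module.finrank ℝ V) (J : Tw V)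
    (S : SType) (γ γ' : Gen) :
    (∀ K : Tw V, γ.sec J K * S.sec J K = S.sec J K * γ'.sec J K) ↔ γ' = γ.tilde S := by
  refine ⟨fun h => ?_, fun h K => h ▸ Gen.mul_S S γ J K⟩
  obtain ⟨K, e, he, hKe⟩ := exists_anticomm h4 J
  obtain ⟨c, hc, hS⟩ := S_S_apply hKe S
  have h1 := congrArg (fun A : V →L[ℝ] V => S.sec J K (A e))
    ((h K).symm.trans (Gen.mul_S S γ J K))
  simp only [mul_apply_eq_comp, hS] at h1
  exact gen_inj he hKe (smul_right_injective V hc h1)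

/-- `γ̃` is the unique element of `{±J, ±φ}` with `S γ = γ̃ S`. -/
theorem Gen.tilde_right_iff [FiniteDimensional ℝ V] (h4 : 4 ≤ Module.finrank ℝ V) (J : Tw V)
    (S : SType) (γ γ' : Gen) :
    (∀ K : Tw V, S.sec J K * γ.sec J K = γ'.sec J K * S.sec J K) ↔ γ' = γ.tilde S := by
  refine ⟨fun h => ?_, fun h K => h ▸ Gen.S_mul S γ J K⟩
  obtain ⟨K, e, he, hKe⟩ := exists_anticomm h4 J
  have h1 := congrArg (fun A : V →L[ℝ] V => A e) ((h K).symm.trans (Gen.S_mul S γ J K))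
  refine gen_inj ?_ (anticomm_S hKe S) h1
  intro h0
  obtain ⟨c, hc, hS⟩ := S_S_apply hKe S
  have h2 := hS .posJ
  rw [← mul_apply_eq_comp, ← mul_apply_eq_comp, mul_assoc, Gen.S_mul,
    ← mul_assoc, Gen.S_mul, mul_assoc, mul_apply_eq_comp,
    mul_apply_eq_comp, h0, map_zero, map_zero] at h2
  have h3 : J.1 e = 0 := (smul_eq_zero.1 h2.symm).resolve_left hc
  apply he
  have h4 := sq_apply J e
  rw [h3, map_zero] at h4
  simpa using h4.symm

/-- The bundle `{A ∈ 𝔬(𝕍,g) | γ A = A δ}`. -/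
def genBundle (J : Tw V) (γ δ : Gen) (K : Tw V) : Submodule ℝ (V →L[ℝ] V) where
  carrier := {A | A ∈ skewEnd V ∧ γ.sec J K * A = A * δ.sec J K}
  add_mem' := by
    rintro A B ⟨hA, hA'⟩ ⟨hB, hB'⟩
    exact ⟨add_mem hA hB, by rw [mul_add, add_mul, hA', hB']⟩
  zero_mem' := ⟨zero_mem _, by simp⟩
  smul_mem' := by
    rintro c A ⟨hA, hA'⟩
    exact ⟨Submodule.smul_mem _ c hA, by rw [mul_smul_comm, smul_mul_assoc, hA']⟩

/-- The four choices `𝔬(𝕍,g)`, `𝔬_{φ}(𝕍)`, `𝔲(𝕍,J)`, `𝔲(𝕍,φ)` for `E`. -/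
inductive EType
  | o | oPhi | uJ | uPhi

/-- The bundle `E`: `𝔬_{φ} = {φA = A(-φ)}`, `𝔲(J) = {JA = AJ}`, `𝔲(φ) = {φA = Aφ}`. -/
def EType.bundle (E : EType) (J : Tw V) (K : Tw V) : Submodule ℝ (V →L[ℝ] V) :=
  match E with
  | .o => skewEnd V
  | .oPhi => genBundle J .posPhi .negPhi K
  | .uJ => genBundle J .posJ .posJ K
  | .uPhi => genBundle J .posPhi .posPhi K

/-- The bundle `E^S`: if `E = {A ∈ 𝔬(𝕍,g) | γ A = A δ}` then
`E^S = {B ∈ 𝔬(𝕍,g) | γ̃ B = B δ̃}`, and `𝔬(𝕍,g)^S = 𝔬(𝕍,g)`. -/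
def EType.bundleS (E : EType) (S : SType) (J : Tw V) (K : Tw V) : Submodule ℝ (V →L[ℝ] V) :=
  match E with
  | .o => skewEnd V
  | .oPhi => genBundle J (Gen.posPhi.tilde S) (Gen.negPhi.tilde S) K
  | .uJ => genBundle J (Gen.posJ.tilde S) (Gen.posJ.tilde S) K
  | .uPhi => genBundle J (Gen.posPhi.tilde S) (Gen.posPhi.tilde S) K

/-- `Q = a_k {J,φ}^k + ⋯ + a_1 {J,φ} + a_0 𝟙`. -/
def polyQ (J : Tw V) {k : ℕ} (a : Fin (k + 1) → Tw V → ℝ) (K : Tw V) : V →L[ℝ] V :=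
  ∑ i : Fin (k + 1), a i K • (J.1 * K.1 + K.1 * J.1) ^ (i : ℕ)

/-- The fibrewise map `A ↦ [F A F, φ]`. -/
def anchor (F : Tw V → (V →L[ℝ] V)) (K : Tw V) : (V →L[ℝ] V) →ₗ[ℝ] (V →L[ℝ] V) where
  toFun A := F K * A * F K * K.1 - K.1 * (F K * A * F K)
  map_add' A B := by simp only [mul_add, add_mul]; abel
  map_smul' c A := by
    simp only [mul_smul_comm, smul_mul_assoc, RingHom.id_apply, smul_sub]

end Twistor

end

open scoped ContDiff Topology InnerProductSpace

noncomputable section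

namespace Twistor

/-! ### Skew endomorphisms and the tangent vectors of `𝒯` -/

section Algebra

variable {V : Type*} [NormedAddCommGroup V] [InnerProductSpace ℝ V]

/-! The bundle `𝔬(𝕍,g)` with anchor `A ↦ [A,φ]` carries the bracket `actionBr`, which the anchor
turns into the Lie bracket of vector fields (`lieBr_commutator`). The bracket on `E^S` is its
pullback under `A ↦ FAF`, a map from `E^S` to `E`.

Since `F` need not be invertible, the factors `F` must be pulled out explicitly. `Q` commutes with
`J` and `φ`, so `γF = Fγ̃` and `Fγ = γ̃F` for `γ ∈ {±J, ±φ}`. Hence the derivative of `φ` along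
`[FAF,φ]` is `FAFφ - φFAF = F(Aφ̃ - φ̃A)F`, while `J` is constant and the `a_i` do not vary in these
directions. By the product rule the shape `F D(A) F` passes to everything built from `J`, `φ` and
the `a_i`, in particular to `F` itself (`IsAdapted`, `isAdapted_polyQ_mul_S`). Therefore `actionBr`
of `FAF` and `FBF` equals `FCF` with an explicit `C`, namely `pullbackBr` (`mul_pullbackBr_mul`).

This `C` need not lie in `E^S`, so it is projected there. Conjugation by `F` carries the projection
onto `E^S` to the projection onto `E` (`conj_genProj`), and it remains to see that projecting
`actionBr` of `FAF` and `FBF` onto `E` does not change its commutator with `φ`. For `𝔬`, `𝔲(J)` and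
`𝔲(φ)` the sections of `E` are closed under `actionBr`; for `𝔬_{φ}` the projection removes only a
part commuting with `φ`. -/

theorem Tw.mul_self (K : Tw V) : K.1 * K.1 = -1 := K.2.1

theorem Tw.mul_self_mul (K : Tw V) (A : V →L[ℝ] V) : K.1 * (K.1 * A) = -A := by
  rw [← mul_assoc, K.mul_self, neg_one_mul]

variable [CompleteSpace V]

theorem mem_skewEnd_iff {A : V →L[ℝ] V} : A ∈ skewEnd V ↔ star A = -A := by
  constructor
  · intro h
    ext x
    refine ext_inner_right ℝ fun y => ?_
    have h' : ⟪A y, x⟫_ℝ = -⟪y, A x⟫_ℝ := h y x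
    rw [ContinuousLinearMap.star_eq_adjoint, ContinuousLinearMap.adjoint_inner_left,
      neg_apply, inner_neg_left, real_inner_comm y (A x), ← h', real_inner_comm]
  · intro h x y
    rw [← ContinuousLinearMap.adjoint_inner_right, ← ContinuousLinearMap.star_eq_adjoint, h,
      neg_apply, inner_neg_right]

theorem Tw.star_eq (K : Tw V) : star K.1 = -K.1 := mem_skewEnd_iff.1 (inner_J K)

theorem mem_twistorSet_of_star {A : V →L[ℝ] V} (h : A * A = -1) (hs : star A = -A) :
    A ∈ twistorSet V := by
  refine ⟨h, fun x y => ?_⟩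
  have h1 : A ∈ skewEnd V := mem_skewEnd_iff.2 hs
  have h2 : ⟪A x, A y⟫_ℝ = -⟪x, A (A y)⟫_ℝ := h1 x (A y)
  have h3 : A (A y) = -y := by simpa using congrArg (fun B : V →L[ℝ] V => B y) h
  rw [h2, h3, inner_neg_right, neg_neg]

theorem commutator_mem_tangent {C : V →L[ℝ] V} (hC : C ∈ skewEnd V) (K : Tw V) :
    C * K.1 - K.1 * C ∈ tangent K := by
  refine ⟨mem_skewEnd_iff.2 ?_, ?_⟩
  · rw [star_sub, star_mul, star_mul, K.star_eq, mem_skewEnd_iff.1 hC]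
    noncomm_ring
  · simp only [sub_mul, mul_sub, mul_assoc, K.mul_self, K.mul_self_mul]
    noncomm_ring

/-- Every `X ∈ T_K 𝒯` is the velocity of the curve `t ↦ exp (-t X K) K` in `𝒯`. -/
theorem tangent_subset_tangentConeAt (K : Tw V) :
    (tangent K : Set (V →L[ℝ] V)) ⊆ tangentConeAt ℝ (twistorSet V) K.1 := by
  rintro X ⟨hX, hXK⟩
  let _ : NormedAlgebra ℚ (V →L[ℝ] V) := NormedAlgebra.restrictScalars ℚ ℝ _
  have hKX : K.1 * X = -(X * K.1) := eq_neg_of_add_eq_zero_right hXK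
  set C : V →L[ℝ] V := -(X * K.1) with hC
  have hCs : star C = -C := by
    rw [hC, star_neg, star_mul, K.star_eq, mem_skewEnd_iff.1 hX, neg_mul_neg, hKX, hC]
  let u : (V →L[ℝ] V)ˣ := ⟨K.1, -K.1, by rw [mul_neg, K.mul_self, neg_neg],
    by rw [neg_mul, K.mul_self, neg_neg]⟩
  -- `K` anticommutes with `C`. This is what makes `exp (tC) K` square to `-1` and be skew, so that
  -- the curve stays in `𝒯`; its velocity at `0` is `CK = X`.
  have hconj : ∀ t : ℝ, K.1 * NormedSpace.exp (t • C) = NormedSpace.exp (-(t • C)) * K.1 := by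
    intro t
    have h := NormedSpace.exp_units_conj u (t • C)
    have h1 : (u : V →L[ℝ] V) * (t • C) * ((u⁻¹ : (V →L[ℝ] V)ˣ) : V →L[ℝ] V) = -(t • C) := by
      change K.1 * (t • C) * (-K.1) = -(t • C)
      rw [mul_neg, mul_smul_comm, smul_mul_assoc, hC, mul_neg, neg_mul, ← mul_assoc, hKX]
      rw [neg_mul, neg_mul, mul_assoc, mul_assoc, K.mul_self_mul]
      simp
    rw [h1] at h
    rw [h]
    change _ = K.1 * _ * (-K.1) * K.1
    rw [mul_assoc _ (-K.1), neg_mul, K.mul_self, neg_neg, mul_one]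
  have hinv : ∀ t : ℝ, NormedSpace.exp (t • C) * NormedSpace.exp (-(t • C)) = 1 := by
    intro t
    rw [← NormedSpace.exp_add_of_commute (Commute.neg_right (Commute.refl _)), add_neg_cancel,
      NormedSpace.exp_zero]
  have hmem : ∀ t : ℝ, NormedSpace.exp (t • C) * K.1 ∈ twistorSet V := by
    intro t
    apply mem_twistorSet_of_star
    · rw [mul_assoc, ← mul_assoc K.1, hconj, mul_assoc, K.mul_self, ← mul_assoc, hinv, one_mul]
    · rw [star_mul, NormedSpace.star_exp, star_smul, hCs, K.star_eq, star_trivial, smul_neg,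
        neg_mul]
      have := hconj (-t)
      rw [neg_smul, neg_neg] at this
      rw [this]
  have hd : HasDerivAt (fun t : ℝ => NormedSpace.exp (t • C) * K.1) X 0 := by
    have h := (hasDerivAt_exp_smul_const (𝕂 := ℝ) C 0).mul_const K.1
    rw [zero_smul, NormedSpace.exp_zero, one_mul, hC, neg_mul, mul_assoc, K.mul_self, mul_neg,
      mul_one, neg_neg] at h
    exact h
  have h := (hd.hasDerivWithinAt (s := Set.univ)).hasFDerivWithinAt.mapsTo_tangent_cone
    (show (1 : ℝ) ∈ _ by rw [tangentConeAt_univ]; trivial)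
  simp only [zero_smul, NormedSpace.exp_zero, one_mul] at h
  have hsub : (fun t : ℝ => NormedSpace.exp (t • C) * K.1) '' Set.univ ⊆ twistorSet V := by
    rintro _ ⟨t, -, rfl⟩
    exact hmem t
  have := tangentConeAt_mono hsub h
  simpa using this

end Algebra

/-! ### Calculus along tangent vectors of `𝒯` -/

section Calculus

variable {V : Type*} [NormedAddCommGroup V] [InnerProductSpace ℝ V]
variable {F G : Type*} [NormedAddCommGroup F] [NormedSpace ℝ F]
  [NormedAddCommGroup G] [NormedSpace ℝ G]

theorem ext_apply {F : Type*} [NormedAddCommGroup F] (f : Tw V → F) (K : Tw V) :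
    ext f K.1 = f K :=
  Subtype.val_injective.extend_apply f 0 K

theorem ext_of_mem {F : Type*} [NormedAddCommGroup F] (f : Tw V → F) {L : V →L[ℝ] V}
    (hL : L ∈ twistorSet V) : ext f L = f ⟨L, hL⟩ :=
  ext_apply f ⟨L, hL⟩

theorem hasFDerivWithinAt_ext {f : Tw V → F} {g : (V →L[ℝ] V) → F} {U : Set (V →L[ℝ] V)}
    {K : Tw V} (hU : IsOpen U) (hK : K.1 ∈ U) (hg : ContDiffOn ℝ ∞ g U)
    (hfg : ∀ L : Tw V, L.1 ∈ U → g L.1 = f L) :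
    HasFDerivWithinAt (ext f) (fderiv ℝ g K.1) (twistorSet V) K.1 := by
  have h1 : HasFDerivWithinAt g (fderiv ℝ g K.1) (twistorSet V) K.1 :=
    ((hg.contDiffAt (hU.mem_nhds hK)).differentiableAt (by simp)).hasFDerivAt.hasFDerivWithinAt
  refine h1.congr_of_eventuallyEq ?_ (by rw [ext_apply, hfg K hK])
  filter_upwards [self_mem_nhdsWithin, mem_nhdsWithin_of_mem_nhds (hU.mem_nhds hK)] with L hL hLU
  rw [hfg ⟨L, hL⟩ hLU, ext_of_mem f hL]

theorem IsSmooth.hasFDerivWithinAt {f : Tw V → F} (hf : IsSmooth f) (K : Tw V) :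
    HasFDerivWithinAt (ext f) (fderivWithin ℝ (ext f) (twistorSet V) K.1) (twistorSet V) K.1 := by
  obtain ⟨U, g, hU, hK, hg, hfg⟩ := hf K
  exact (hasFDerivWithinAt_ext hU hK hg hfg).differentiableWithinAt.hasFDerivWithinAt

theorem dd_add_right (f : Tw V → F) (K : Tw V) (X Y : V →L[ℝ] V) :
    dd f K (X + Y) = dd f K X + dd f K Y := map_add _ _ _

theorem dd_smul_right (f : Tw V → F) (K : Tw V) (c : ℝ) (X : V →L[ℝ] V) :
    dd f K (c • X) = c • dd f K X := map_smul _ _ _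

theorem isSmooth_val : IsSmooth (fun K : Tw V => K.1) := fun _ =>
  ⟨Set.univ, id, isOpen_univ, trivial, contDiffOn_id, fun _ _ => rfl⟩

theorem IsSmooth.contDiff_comp {f : Tw V → F} (hf : IsSmooth f) {T : F → G}
    (hT : ContDiff ℝ ∞ T) : IsSmooth (fun K => T (f K)) := by
  intro K
  obtain ⟨U, g, hU, hK, hg, hfg⟩ := hf K
  exact ⟨U, fun x => T (g x), hU, hK, hT.comp_contDiffOn hg,
    fun L hL => by simp only [hfg L hL]⟩

theorem IsSmooth.clm_comp {f : Tw V → F} (hf : IsSmooth f) (T : F →L[ℝ] G) :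
    IsSmooth (fun K => T (f K)) :=
  hf.contDiff_comp T.contDiff

theorem IsSmooth.neg {f : Tw V → F} (hf : IsSmooth f) : IsSmooth (fun K => -f K) := by
  simpa using hf.clm_comp (-ContinuousLinearMap.id ℝ F)

theorem IsSmooth.sub {f g : Tw V → F} (hf : IsSmooth f) (hg : IsSmooth g) :
    IsSmooth (fun K => f K - g K) := by
  simp only [sub_eq_add_neg]
  exact hf.add hg.neg

theorem IsSmooth.clm_apply {f : Tw V → F →L[ℝ] G} {g : Tw V → F} (hf : IsSmooth f)
    (hg : IsSmooth g) : IsSmooth (fun K => f K (g K)) := by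
  intro K
  obtain ⟨U, f', hU, hKU, hf', hff⟩ := hf K
  obtain ⟨W, g', hW, hKW, hg', hgg⟩ := hg K
  exact ⟨U ∩ W, fun x => f' x (g' x), hU.inter hW, ⟨hKU, hKW⟩,
    (hf'.mono Set.inter_subset_left).clm_apply (hg'.mono Set.inter_subset_right),
    fun L hL => by simp only [hff L hL.1, hgg L hL.2]⟩

theorem IsSmooth.mul {f g : Tw V → (V →L[ℝ] V)} (hf : IsSmooth f) (hg : IsSmooth g) :
    IsSmooth (fun K => f K * g K) :=
  (hf.clm_comp (ContinuousLinearMap.mul ℝ (V →L[ℝ] V))).clm_apply hg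

theorem IsSmooth.continuous {f : Tw V → F} (hf : IsSmooth f) : Continuous f := by
  refine continuous_iff_continuousAt.2 fun K => ?_
  obtain ⟨U, g, hU, hK, hg, hfg⟩ := hf K
  have h1 : ContinuousAt (fun L : Tw V => g L.1) K :=
    ContinuousAt.comp (hg.continuousOn.continuousAt (hU.mem_nhds hK))
      continuous_subtype_val.continuousAt
  refine h1.congr ?_
  filter_upwards [(hU.preimage continuous_subtype_val).mem_nhds hK] with L hL using hfg L hL

theorem lieBr_apply (X Y : Tw V → (V →L[ℝ] V)) (K : Tw V) :
    lieBr X Y K = dd Y K (X K) - dd X K (Y K) := by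
  simp only [lieBr, VectorField.lieBracketWithin, dd, ext_apply]

variable [CompleteSpace V]

/-- A derivative within `𝒯` is not unique on all of `End V`, but any two agree on the tangent cone,
which contains `T_K 𝒯`. All the rules for `dd` below rest on this, and therefore ask for a tangent
direction. -/
theorem dd_eq {f : Tw V → F} {f' : (V →L[ℝ] V) →L[ℝ] F} {K : Tw V} {X : V →L[ℝ] V}
    (hf : HasFDerivWithinAt (ext f) f' (twistorSet V) K.1) (hX : X ∈ tangent K) :
    dd f K X = f' X :=
  hf.differentiableWithinAt.hasFDerivWithinAt.unique_on hf (tangent_subset_tangentConeAt K hX)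

theorem dd_const (c : F) {K : Tw V} {X : V →L[ℝ] V} (hX : X ∈ tangent K) :
    dd (fun _ : Tw V => c) K X = 0 := by
  have := dd_eq (hasFDerivWithinAt_ext (f := fun _ : Tw V => c) (g := fun _ => c) isOpen_univ
    (Set.mem_univ K.1) contDiffOn_const (fun _ _ => rfl)) hX
  simpa using this

theorem dd_val {K : Tw V} {X : V →L[ℝ] V} (hX : X ∈ tangent K) :
    dd (fun L : Tw V => L.1) K X = X := by
  have := dd_eq (hasFDerivWithinAt_ext (f := fun L : Tw V => L.1) (g := id) isOpen_univ
    (Set.mem_univ K.1) contDiffOn_id (fun _ _ => rfl)) hX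
  simpa using this

theorem dd_add {f g : Tw V → F} (hf : IsSmooth f) (hg : IsSmooth g) {K : Tw V} {X : V →L[ℝ] V}
    (hX : X ∈ tangent K) : dd (fun L => f L + g L) K X = dd f K X + dd g K X := by
  refine dd_eq (f := fun L => f L + g L) (((hf.hasFDerivWithinAt K).add
    (hg.hasFDerivWithinAt K)).congr (fun L hL => ?_) ?_) hX
  · simp only [Pi.add_apply, ext_of_mem _ hL]
  · simp only [Pi.add_apply, ext_apply]

theorem dd_clm_comp {f : Tw V → F} (hf : IsSmooth f) (T : F →L[ℝ] G) {K : Tw V} {X : V →L[ℝ] V}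
    (hX : X ∈ tangent K) : dd (fun L => T (f L)) K X = T (dd f K X) := by
  refine dd_eq (f := fun L => T (f L)) ((T.hasFDerivAt.comp_hasFDerivWithinAt K.1
    (hf.hasFDerivWithinAt K)).congr (fun L hL => ?_) ?_) hX
  · simp only [Function.comp_apply, ext_of_mem _ hL]
  · simp only [Function.comp_apply, ext_apply]

theorem dd_smul {a : Tw V → ℝ} {f : Tw V → F} (ha : IsSmooth a) (hf : IsSmooth f) {K : Tw V}
    {X : V →L[ℝ] V} (hX : X ∈ tangent K) :
    dd (fun L => a L • f L) K X = a K • dd f K X + dd a K X • f K := by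
  have h := dd_eq (f := fun L => a L • f L) (((ha.hasFDerivWithinAt K).smul
    (hf.hasFDerivWithinAt K)).congr (fun L hL => ?_) ?_) hX
  · simpa [ext_apply, dd] using h
  · simp only [Pi.smul_apply', ext_of_mem _ hL]
  · simp only [Pi.smul_apply', ext_apply]

theorem dd_mul {f g : Tw V → (V →L[ℝ] V)} (hf : IsSmooth f) (hg : IsSmooth g) {K : Tw V}
    {X : V →L[ℝ] V} (hX : X ∈ tangent K) :
    dd (fun L => f L * g L) K X = dd f K X * g K + f K * dd g K X := by
  have h := dd_eq (f := fun L => f L * g L) (((hf.hasFDerivWithinAt K).mul'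
    (hg.hasFDerivWithinAt K)).congr (fun L hL => ?_) ?_) hX
  · rw [h]
    simp [ext_apply, add_comm, dd]
  · simp only [Pi.mul_apply, ext_of_mem _ hL]
  · simp only [Pi.mul_apply, ext_apply]

theorem dd_neg {f : Tw V → F} (hf : IsSmooth f) {K : Tw V} {X : V →L[ℝ] V}
    (hX : X ∈ tangent K) : dd (fun L => -f L) K X = -dd f K X := by
  simpa using dd_clm_comp hf (-ContinuousLinearMap.id ℝ F) hX

theorem dd_sub {f g : Tw V → F} (hf : IsSmooth f) (hg : IsSmooth g) {K : Tw V} {X : V →L[ℝ] V}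
    (hX : X ∈ tangent K) : dd (fun L => f L - g L) K X = dd f K X - dd g K X := by
  simp only [sub_eq_add_neg]
  rw [dd_add hf hg.neg hX, dd_neg hg hX]

/-- Along a tangent field, `dd f` agrees with the ordinary derivative of any local smooth extension
of `f`, and the latter varies smoothly. -/
theorem IsSmooth.dd {f : Tw V → F} {X : Tw V → (V →L[ℝ] V)} (hf : IsSmooth f) (hX : IsSmooth X)
    (hXt : ∀ K, X K ∈ tangent K) : IsSmooth (fun K => dd f K (X K)) := by
  intro K
  obtain ⟨U, f', hU, hKU, hf', hff⟩ := hf K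
  obtain ⟨W, X', hW, hKW, hX', hXX⟩ := hX K
  refine ⟨U ∩ W, fun x => fderiv ℝ f' x (X' x), hU.inter hW, ⟨hKU, hKW⟩,
    ((hf'.fderiv_of_isOpen hU (by simp)).mono Set.inter_subset_left).clm_apply
      (hX'.mono Set.inter_subset_right), fun L hL => ?_⟩
  simp only [dd_eq (hasFDerivWithinAt_ext hU hL.1 hf' hff) (hXt L), hXX L hL.2]

end Calculus

/-! ### Smooth projections and subbundles -/

section Projection

theorem contDiff_sub_smul_mulLeftRight_comp {R : Type*} [NormedRing R] [NormedAlgebra ℝ R]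
    (σ : ℝ) (T : R →L[ℝ] R) :
    ContDiff ℝ ∞ fun η : R =>
      (1 / 2 : ℝ) • (T - σ • (ContinuousLinearMap.mulLeftRight ℝ R η η).comp T) := by
  have h : ContDiff ℝ ∞ fun η : R => ContinuousLinearMap.mulLeftRight ℝ R η η :=
    (ContinuousLinearMap.mulLeftRight ℝ R).contDiff.clm_apply contDiff_id
  have h' : ContDiff ℝ ∞ fun η : R => (ContinuousLinearMap.mulLeftRight ℝ R η η).comp T :=
    h.clm_comp contDiff_const
  exact (contDiff_const.sub (h'.const_smul σ)).const_smul (1 / 2 : ℝ)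

/-- Two nearby projections `P` and `P₀` are conjugate by `P ∘ P₀ + (1 - P) ∘ (1 - P₀)`. -/
theorem exists_isOpen_bijective_of_projection {X W : Type*} [TopologicalSpace X]
    [NormedAddCommGroup W] [NormedSpace ℝ W] [CompleteSpace W] {P : X → W →L[ℝ] W}
    (hP : Continuous P) (x₀ : X) (h₀ : P x₀ * P x₀ = P x₀) :
    ∃ U : Set X, IsOpen U ∧ x₀ ∈ U ∧
      ∀ x ∈ U, Function.Bijective (P x * P x₀ + (1 - P x) * (1 - P x₀) : W →L[ℝ] W) := by
  let Φ : X → W →L[ℝ] W := fun x => P x * P x₀ + (1 - P x) * (1 - P x₀)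
  have hcont : Continuous Φ :=
    (hP.mul continuous_const).add ((continuous_const.sub hP).mul continuous_const)
  have hΦ₀ : Φ x₀ = 1 := by
    simp only [Φ, mul_sub, sub_mul, h₀]
    simp
  refine ⟨Φ ⁻¹' {T | IsUnit T}, Units.isOpen.preimage hcont, by simp [hΦ₀], fun x hx => ?_⟩
  obtain ⟨u, hu⟩ : IsUnit (Φ x) := hx
  change Function.Bijective (Φ x)
  rw [← hu]
  refine Function.bijective_iff_has_inverse.2 ⟨(↑u⁻¹ : W →L[ℝ] W), fun A => ?_, fun A => ?_⟩
  · rw [← mul_apply_eq_comp, Units.inv_mul, one_apply_eq_self]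
  · rw [← mul_apply_eq_comp, Units.mul_inv, one_apply_eq_self]

variable {V : Type*} [NormedAddCommGroup V] [InnerProductSpace ℝ V]

/-- `P` is a smooth family of projections of `End V` onto the fibres of `E`. -/
structure IsBundleProj (E : Tw V → Submodule ℝ (V →L[ℝ] V))
    (P : Tw V → (V →L[ℝ] V) →L[ℝ] (V →L[ℝ] V)) : Prop where
  smooth : IsSmooth P
  mem : ∀ K A, P K A ∈ E K
  fix : ∀ K, ∀ A ∈ E K, P K A = A

/-- The image of a smooth projection is a subbundle: near `K₀` the operators
`P K ∘ P K₀ + (1 - P K) ∘ (1 - P K₀)` are invertible and carry `E K₀` onto `E K`. -/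
theorem IsBundleProj.isSubbundle [FiniteDimensional ℝ V]
    {E : Tw V → Submodule ℝ (V →L[ℝ] V)} {P : Tw V → (V →L[ℝ] V) →L[ℝ] (V →L[ℝ] V)}
    (hP : IsBundleProj E P) : IsSubbundle E := by
  intro K₀
  let Φ : Tw V → (V →L[ℝ] V) →L[ℝ] (V →L[ℝ] V) :=
    fun K => P K * P K₀ + (1 - P K) * (1 - P K₀)
  have hΦ : ∀ K, ∀ A ∈ E K₀, Φ K A = P K A := by
    intro K A hA
    simp [Φ, hP.fix K₀ A hA]
  have hidem : ∀ K, P K * P K = P K := by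
    intro K
    ext1 A
    exact hP.fix K _ (hP.mem K A)
  have : CompleteSpace V := FiniteDimensional.complete ℝ V
  obtain ⟨U, hU, hK₀, hbij⟩ :=
    exists_isOpen_bijective_of_projection hP.smooth.continuous K₀ (hidem K₀)
  let b := Module.finBasis ℝ (E K₀)
  refine ⟨U, _, fun i K => P K (b i), hU, hK₀, ?_, ?_⟩
  · intro i K _
    exact (hP.smooth.clm_apply (isSmooth_const _)) K
  · intro K hK
    obtain ⟨hinj, hsurj⟩ : Function.Bijective (Φ K) := hbij K hK
    constructor
    · have h1 : LinearIndependent ℝ (fun i => (b i : V →L[ℝ] V)) :=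
        b.linearIndependent.map' (E K₀).subtype (Submodule.ker_subtype _)
      have h2 := h1.map' (Φ K : (V →L[ℝ] V) →ₗ[ℝ] (V →L[ℝ] V)) (LinearMap.ker_eq_bot.2 hinj)
      have h3 : (fun i => P K (b i)) =
          (Φ K : (V →L[ℝ] V) →ₗ[ℝ] (V →L[ℝ] V)) ∘ fun i => (b i : V →L[ℝ] V) :=
        funext fun i => (hΦ K (b i) (b i).2).symm
      rw [h3]
      exact h2
    · apply le_antisymm
      · rw [Submodule.span_le]
        rintro _ ⟨i, rfl⟩
        exact hP.mem K _
      · intro B hB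
        obtain ⟨A, rfl⟩ := hsurj B
        -- As `Φ K A` lies in `E K`, it is fixed by `P K`, and `P K` kills the summand with `1 - P
        -- K`.
        have h1 : Φ K A = P K (P K₀ A) := by
          have h2 := hP.fix K _ hB
          rw [← h2, ← mul_apply_eq_comp, ← mul_apply_eq_comp]
          congr 1
          simp only [Φ, mul_add, mul_sub, sub_mul, ← mul_assoc, hidem]
          simp
        rw [h1]
        have h3 : (⟨P K₀ A, hP.mem K₀ A⟩ : E K₀) ∈ Submodule.span ℝ (Set.range b) := by
          rw [b.span_eq]; trivial
        have h4 := Submodule.mem_map_of_mem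
          (f := (P K : (V →L[ℝ] V) →ₗ[ℝ] (V →L[ℝ] V)) ∘ₗ (E K₀).subtype) h3
        rw [Submodule.map_span, ← Set.range_comp] at h4
        exact h4

theorem Gen.mul_self (γ : Gen) (J K : Tw V) : γ.sec J K * γ.sec J K = -1 := by
  cases γ <;> simp [Gen.sec, Tw.mul_self]

theorem Gen.isSmooth (γ : Gen) (J : Tw V) : IsSmooth (γ.sec J) := by
  cases γ
  · exact isSmooth_const _
  · exact isSmooth_const _
  · exact isSmooth_val
  · exact isSmooth_val.neg

variable [CompleteSpace V]

theorem Gen.star_eq (γ : Gen) (J K : Tw V) : star (γ.sec J K) = -γ.sec J K := by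
  cases γ <;> simp [Gen.sec, Tw.star_eq]

variable (V) in
/-- The projection of `End V` onto `𝔬(V,g)`. -/
def skewProj : (V →L[ℝ] V) →L[ℝ] (V →L[ℝ] V) :=
  (1 / 2 : ℝ) • (ContinuousLinearMap.id ℝ (V →L[ℝ] V) -
    (starL' ℝ : (V →L[ℝ] V) ≃L[ℝ] (V →L[ℝ] V)).toContinuousLinearMap)

theorem skewProj_apply (A : V →L[ℝ] V) : skewProj V A = (1 / 2 : ℝ) • (A - star A) := rfl

theorem skewProj_mem (A : V →L[ℝ] V) : skewProj V A ∈ skewEnd V := by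
  rw [mem_skewEnd_iff, skewProj_apply, star_smul, star_sub, star_star, star_trivial, ← smul_neg,
    neg_sub]

theorem skewProj_of_mem {A : V →L[ℝ] V} (hA : A ∈ skewEnd V) : skewProj V A = A := by
  rw [skewProj_apply, mem_skewEnd_iff.1 hA]
  module

/-- For an orthogonal complex structure `η` and `σ = ±1`, the projection of `End V` onto
`{A ∈ 𝔬(V,g) | η A = σ A η}`. -/
def genProj (σ : ℝ) (η : V →L[ℝ] V) : (V →L[ℝ] V) →L[ℝ] (V →L[ℝ] V) :=
  (1 / 2 : ℝ) • (skewProj V -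
    σ • (ContinuousLinearMap.mulLeftRight ℝ (V →L[ℝ] V) η η).comp (skewProj V))

theorem genProj_apply (σ : ℝ) (η A : V →L[ℝ] V) :
    genProj σ η A = (1 / 2 : ℝ) • (skewProj V A - σ • (η * skewProj V A * η)) := by
  simp [genProj]

theorem isSmooth_genProj (σ : ℝ) {η : Tw V → (V →L[ℝ] V)} (hη : IsSmooth η) :
    IsSmooth (fun K => genProj σ (η K)) :=
  hη.contDiff_comp (contDiff_sub_smul_mulLeftRight_comp σ (skewProj V))

theorem isBundleProj_skew : IsBundleProj (fun _ : Tw V => skewEnd V) (fun _ => skewProj V) :=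
  ⟨isSmooth_const _, fun _ => skewProj_mem, fun _ _ => skewProj_of_mem⟩

/-- On skew endomorphisms `A ↦ -σ γAγ` is an involution, because `γ² = -1` and `σ² = 1`. Its fixed
points are the `A` with `γA = σAγ`, and `genProj` averages over it. -/
theorem isBundleProj_gen (J : Tw V) {γ δ : Gen} {σ : ℝ} (hσ : σ * σ = 1)
    (hδ : ∀ K, δ.sec J K = σ • γ.sec J K) :
    IsBundleProj (genBundle J γ δ) (fun K => genProj σ (γ.sec J K)) := by
  refine ⟨isSmooth_genProj σ (γ.isSmooth J), fun K A => ⟨?_, ?_⟩, fun K A hA => ?_⟩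
  · have h := mem_skewEnd_iff.1 (skewProj_mem A)
    rw [genProj_apply, mem_skewEnd_iff]
    simp only [star_smul, star_sub, star_mul, γ.star_eq, h, star_trivial, mul_neg, neg_mul,
      neg_neg, mul_assoc]
    module
  · rw [genProj_apply, hδ]
    have h1 : ∀ B, γ.sec J K * (γ.sec J K * B) = -B := fun B => by
      rw [← mul_assoc, γ.mul_self, neg_one_mul]
    simp only [mul_smul_comm, smul_mul_assoc, mul_sub, sub_mul, mul_assoc, γ.mul_self, h1,
      smul_sub, smul_smul, mul_neg, mul_one, smul_neg]
    have h2 : σ * (1 / 2 * σ) = 1 / 2 := by linear_combination (1 / 2) * hσ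
    rw [h2, mul_comm (1 / 2) σ]
    module
  · have h1 : γ.sec J K * A = σ • (A * γ.sec J K) := by
      rw [hA.2, hδ, mul_smul_comm]
    rw [genProj_apply, skewProj_of_mem hA.1, h1, smul_mul_assoc, mul_assoc, γ.mul_self, smul_smul,
      hσ]
    simp only [mul_neg, mul_one]
    module

end Projection

/-! ### Sections whose derivative along the anchor factors through `F` -/

section Adapted

variable {V : Type*} [NormedAddCommGroup V] [InnerProductSpace ℝ V]

theorem anchor_apply (F : Tw V → (V →L[ℝ] V)) (K : Tw V) (A : V →L[ℝ] V) :
    anchor F K A = F K * A * F K * K.1 - K.1 * (F K * A * F K) := rfl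

/-- A section `G` of `𝔤𝔩(𝕍)` is adapted to `F` if it can be moved past `F` on either side and if
its derivative along `[F A F, φ]` has the form `F D(A) F`. -/
structure IsAdapted (E : Tw V → Submodule ℝ (V →L[ℝ] V)) (F G : Tw V → (V →L[ℝ] V)) : Prop where
  smooth : IsSmooth G
  left : ∃ G' : Tw V → (V →L[ℝ] V), IsSmooth G' ∧ ∀ K, G K * F K = F K * G' K
  right : ∃ G' : Tw V → (V →L[ℝ] V), IsSmooth G' ∧ ∀ K, F K * G K = G' K * F K
  deriv : ∃ D : Tw V → (V →L[ℝ] V) →ₗ[ℝ] (V →L[ℝ] V),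
    (∀ A : Tw V → (V →L[ℝ] V), IsSmooth A → IsSmooth fun K => D K (A K)) ∧
    ∀ K, ∀ A ∈ E K, dd G K (anchor F K A) = F K * D K A * F K

variable [CompleteSpace V]
variable {E : Tw V → Submodule ℝ (V →L[ℝ] V)} {F G H : Tw V → (V →L[ℝ] V)}

theorem IsAdapted.add (ht : ∀ K, ∀ A ∈ E K, anchor F K A ∈ tangent K)
    (hG : IsAdapted E F G) (hH : IsAdapted E F H) : IsAdapted E F (fun K => G K + H K) := by
  obtain ⟨G₁, hG₁, hGl⟩ := hG.left
  obtain ⟨G₂, hG₂, hGr⟩ := hG.right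
  obtain ⟨H₁, hH₁, hHl⟩ := hH.left
  obtain ⟨H₂, hH₂, hHr⟩ := hH.right
  obtain ⟨D, hD, hdG⟩ := hG.deriv
  obtain ⟨D', hD', hdH⟩ := hH.deriv
  refine ⟨hG.smooth.add hH.smooth, ⟨fun K => G₁ K + H₁ K, hG₁.add hH₁, fun K => ?_⟩,
    ⟨fun K => G₂ K + H₂ K, hG₂.add hH₂, fun K => ?_⟩,
    ⟨fun K => D K + D' K, fun A hA => (hD A hA).add (hD' A hA), fun K A hA => ?_⟩⟩
  · rw [add_mul, mul_add, hGl, hHl]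
  · rw [add_mul, mul_add, hGr, hHr]
  · rw [dd_add hG.smooth hH.smooth (ht K A hA), hdG K A hA, hdH K A hA, LinearMap.add_apply,
      mul_add, add_mul]

/-- The product rule gives `F D(A) F H + G F D'(A) F`. Moving `H` to the left and `G` to the right
across the adjacent `F` restores the shape `F (⋯) F`. -/
theorem IsAdapted.mul (ht : ∀ K, ∀ A ∈ E K, anchor F K A ∈ tangent K)
    (hG : IsAdapted E F G) (hH : IsAdapted E F H) : IsAdapted E F (fun K => G K * H K) := by
  obtain ⟨G₁, hG₁, hGl⟩ := hG.left
  obtain ⟨G₂, hG₂, hGr⟩ := hG.right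
  obtain ⟨H₁, hH₁, hHl⟩ := hH.left
  obtain ⟨H₂, hH₂, hHr⟩ := hH.right
  obtain ⟨D, hD, hdG⟩ := hG.deriv
  obtain ⟨D', hD', hdH⟩ := hH.deriv
  refine ⟨hG.smooth.mul hH.smooth, ⟨fun K => G₁ K * H₁ K, hG₁.mul hH₁, fun K => ?_⟩,
    ⟨fun K => G₂ K * H₂ K, hG₂.mul hH₂, fun K => ?_⟩,
    ⟨fun K => LinearMap.mulRight ℝ (H₂ K) ∘ₗ D K + LinearMap.mulLeft ℝ (G₁ K) ∘ₗ D' K,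
      fun A hA => ((hD A hA).mul hH₂).add (hG₁.mul (hD' A hA)), fun K A hA => ?_⟩⟩
  · rw [mul_assoc, hHl, ← mul_assoc, hGl, mul_assoc]
  · rw [← mul_assoc, hGr, mul_assoc, hHr, mul_assoc]
  · rw [dd_mul hG.smooth hH.smooth (ht K A hA), hdG K A hA, hdH K A hA]
    simp only [LinearMap.add_apply, LinearMap.comp_apply, LinearMap.mulRight_apply,
      LinearMap.mulLeft_apply, mul_add, add_mul]
    congr 1
    · rw [mul_assoc _ (F K), hHr]
      simp only [mul_assoc]
    · rw [← mul_assoc, ← mul_assoc, hGl]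
      simp only [mul_assoc]

theorem IsAdapted.neg (ht : ∀ K, ∀ A ∈ E K, anchor F K A ∈ tangent K)
    (hG : IsAdapted E F G) : IsAdapted E F (fun K => -G K) := by
  obtain ⟨G₁, hG₁, hGl⟩ := hG.left
  obtain ⟨G₂, hG₂, hGr⟩ := hG.right
  obtain ⟨D, hD, hdG⟩ := hG.deriv
  refine ⟨hG.smooth.neg, ⟨fun K => -G₁ K, hG₁.neg, fun K => ?_⟩,
    ⟨fun K => -G₂ K, hG₂.neg, fun K => ?_⟩,
    ⟨fun K => -D K, fun A hA => (hD A hA).neg, fun K A hA => ?_⟩⟩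
  · rw [neg_mul, mul_neg, hGl]
  · rw [neg_mul, mul_neg, hGr]
  · rw [dd_neg hG.smooth (ht K A hA), hdG K A hA, LinearMap.neg_apply, mul_neg, neg_mul]

/-- A scalar function constant along the image of the anchor is adapted. -/
theorem isAdapted_smul_one (ht : ∀ K, ∀ A ∈ E K, anchor F K A ∈ tangent K) {a : Tw V → ℝ}
    (ha : IsSmooth a) (hda : ∀ K, ∀ A ∈ E K, dd a K (anchor F K A) = 0) :
    IsAdapted E F (fun K => a K • (1 : V →L[ℝ] V)) := by
  have hs : IsSmooth (fun K => a K • (1 : V →L[ℝ] V)) := ha.smul (isSmooth_const _)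
  refine ⟨hs, ⟨_, hs, fun K => ?_⟩, ⟨_, hs, fun K => ?_⟩,
    ⟨fun K => 0, fun A _ => isSmooth_const 0, fun K A hA => ?_⟩⟩
  · rw [smul_one_mul, mul_smul_comm, mul_one]
  · rw [smul_one_mul, mul_smul_comm, mul_one]
  · rw [dd_smul ha (isSmooth_const _) (ht K A hA), dd_const _ (ht K A hA), hda K A hA]
    simp

theorem isAdapted_one (ht : ∀ K, ∀ A ∈ E K, anchor F K A ∈ tangent K) :
    IsAdapted E F (fun _ => 1) := by
  simpa using isAdapted_smul_one ht (isSmooth_const (1 : ℝ))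
    (fun K A hA => dd_const 1 (ht K A hA))

theorem IsAdapted.pow (ht : ∀ K, ∀ A ∈ E K, anchor F K A ∈ tangent K)
    (hG : IsAdapted E F G) (n : ℕ) : IsAdapted E F (fun K => G K ^ n) := by
  induction n with
  | zero => simpa using isAdapted_one ht
  | succ n ih => simpa only [pow_succ] using ih.mul ht hG

theorem isAdapted_sum (ht : ∀ K, ∀ A ∈ E K, anchor F K A ∈ tangent K) {ι : Type*}
    (s : Finset ι) {G : ι → Tw V → (V →L[ℝ] V)} (hG : ∀ i, IsAdapted E F (G i)) :
    IsAdapted E F (fun K => ∑ i ∈ s, G i K) := by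
  classical
  induction s using Finset.induction_on with
  | empty =>
    simpa using isAdapted_smul_one ht (isSmooth_const (0 : ℝ))
      (fun K A hA => dd_const 0 (ht K A hA))
  | insert i s hi ih => simpa only [Finset.sum_insert hi] using (hG i).add ht ih

/-- A constant section that can be moved past `F` is adapted. -/
theorem isAdapted_const (ht : ∀ K, ∀ A ∈ E K, anchor F K A ∈ tangent K) (B : V →L[ℝ] V)
    {B' : Tw V → (V →L[ℝ] V)} (hB' : IsSmooth B') (hl : ∀ K, B * F K = F K * B' K)
    (hr : ∀ K, F K * B = B' K * F K) : IsAdapted E F (fun _ => B) :=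
  ⟨isSmooth_const B, ⟨B', hB', hl⟩, ⟨B', hB', hr⟩,
    ⟨fun _ => 0, fun _ _ => isSmooth_const 0, fun K A hA => by
      rw [dd_const B (ht K A hA)]; simp⟩⟩

/-- The tautological section is adapted if it can be moved past `F`. -/
theorem isAdapted_val (ht : ∀ K, ∀ A ∈ E K, anchor F K A ∈ tangent K)
    {B' : Tw V → (V →L[ℝ] V)} (hB' : IsSmooth B') (hl : ∀ K : Tw V, K.1 * F K = F K * B' K)
    (hr : ∀ K : Tw V, F K * K.1 = B' K * F K) : IsAdapted E F (fun K => K.1) :=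
  ⟨isSmooth_val, ⟨B', hB', hl⟩, ⟨B', hB', hr⟩,
    -- Here `D(A) = AB' - B'A`, since `FAFφ = FAB'F` and `φFAF = FB'AF`.
    ⟨fun K => LinearMap.mulRight ℝ (B' K) - LinearMap.mulLeft ℝ (B' K),
      fun A hA => (hA.mul hB').sub (hB'.mul hA), fun K A hA => by
      rw [dd_val (ht K A hA), anchor_apply, mul_assoc _ (F K), hr, ← mul_assoc K.1,
        ← mul_assoc K.1, hl]
      simp only [LinearMap.sub_apply, LinearMap.mulRight_apply, LinearMap.mulLeft_apply, mul_sub,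
        sub_mul, mul_assoc]⟩⟩

end Adapted

/-! ### The action bracket and its pullback -/

section Bracket

variable {V : Type*} [NormedAddCommGroup V] [InnerProductSpace ℝ V]

/-- The bracket of the action algebroid `𝔬(𝕍,g)` with anchor `A ↦ [A, φ]`. -/
def actionBr (A B : Tw V → (V →L[ℝ] V)) (K : Tw V) : V →L[ℝ] V :=
  dd B K (A K * K.1 - K.1 * A K) - dd A K (B K * K.1 - K.1 * B K) - (A K * B K - B K * A K)

/-- The pullback of `actionBr` under `A ↦ F A F`, where `D` is a fibrewise map such that the
derivative of `F` along `[F A F, φ]` is `F D(A) F`. -/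
def pullbackBr (F : Tw V → (V →L[ℝ] V)) (D : Tw V → (V →L[ℝ] V) →ₗ[ℝ] (V →L[ℝ] V))
    (A B : Tw V → (V →L[ℝ] V)) (K : Tw V) : V →L[ℝ] V :=
  dd B K (anchor F K (A K)) - dd A K (anchor F K (B K))
    + (D K (A K) * F K * B K + B K * F K * D K (A K))
    - (D K (B K) * F K * A K + A K * F K * D K (B K))
    - (A K * F K * F K * B K - B K * F K * F K * A K)

theorem pullbackBr_neg_swap (F : Tw V → (V →L[ℝ] V))
    (D : Tw V → (V →L[ℝ] V) →ₗ[ℝ] (V →L[ℝ] V)) (A B : Tw V → (V →L[ℝ] V)) (K : Tw V) :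
    pullbackBr F D A B K = -pullbackBr F D B A K := by
  simp only [pullbackBr]
  abel

theorem isSmooth_anchor {F : Tw V → (V →L[ℝ] V)} (hF : IsSmooth F) {A : Tw V → (V →L[ℝ] V)}
    (hA : IsSmooth A) :
    IsSmooth (fun K => anchor F K (A K)) :=
  (((hF.mul hA).mul hF).mul isSmooth_val).sub (isSmooth_val.mul ((hF.mul hA).mul hF))

variable [CompleteSpace V]

/-- `A ↦ [A, φ]` intertwines `actionBr` with the Lie bracket of vector fields. -/
theorem lieBr_commutator {A B : Tw V → (V →L[ℝ] V)} (hA : IsSmooth A) (hB : IsSmooth B)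
    (hA' : ∀ K, A K ∈ skewEnd V) (hB' : ∀ K, B K ∈ skewEnd V) (K : Tw V) :
    lieBr (fun K => A K * K.1 - K.1 * A K) (fun K => B K * K.1 - K.1 * B K) K =
      actionBr A B K * K.1 - K.1 * actionBr A B K := by
  have hX := commutator_mem_tangent (hA' K) K
  have hY := commutator_mem_tangent (hB' K) K
  have key : ∀ {C : Tw V → (V →L[ℝ] V)} {X : V →L[ℝ] V}, IsSmooth C → X ∈ tangent K →
      dd (fun K => C K * K.1 - K.1 * C K) K X =
        dd C K X * K.1 + C K * X - (X * C K + K.1 * dd C K X) := by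
    intro C X hC hX
    rw [dd_sub (hC.mul isSmooth_val) (isSmooth_val.mul hC) hX, dd_mul hC isSmooth_val hX,
      dd_mul isSmooth_val hC hX, dd_val hX]
  -- For constant `A`, `B` the identity is Jacobi's, `[B,[A,φ]] - [A,[B,φ]] = -[[A,B],φ]`, whence
  -- the minus sign before the commutator in `actionBr`.
  rw [lieBr_apply, key hB hX, key hA hY, actionBr]
  noncomm_ring

variable {E : Tw V → Submodule ℝ (V →L[ℝ] V)} {F : Tw V → (V →L[ℝ] V)}
  {D : Tw V → (V →L[ℝ] V) →ₗ[ℝ] (V →L[ℝ] V)} {P : Tw V → (V →L[ℝ] V) →L[ℝ] (V →L[ℝ] V)}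

/-- Differentiating `FBF` along `[FAF,φ]` gives three terms, and since the derivative of `F` is `F
D(A) F`, each of them has `F` as its outermost factor on both sides. No inverse of `F` is needed. -/
theorem mul_pullbackBr_mul (ht : ∀ K, ∀ A ∈ E K, anchor F K A ∈ tangent K) (hF : IsSmooth F)
    (hD : ∀ K, ∀ A ∈ E K, dd F K (anchor F K A) = F K * D K A * F K)
    {A B : Tw V → (V →L[ℝ] V)} (hA : A ∈ Gam E) (hB : B ∈ Gam E) (K : Tw V) :
    F K * pullbackBr F D A B K * F K =
      actionBr (fun K => F K * A K * F K) (fun K => F K * B K * F K) K := by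
  have key : ∀ {A B : Tw V → (V →L[ℝ] V)}, A ∈ Gam E → B ∈ Gam E →
      dd (fun K => F K * B K * F K) K (anchor F K (A K)) =
        F K * D K (A K) * F K * B K * F K + F K * dd B K (anchor F K (A K)) * F K
          + F K * B K * (F K * D K (A K) * F K) := by
    intro A B hA hB
    have hX := ht K _ (hA.2 K)
    rw [dd_mul (hF.mul hB.1) hF hX, dd_mul hF hB.1 hX, hD K _ (hA.2 K), add_mul]
  rw [actionBr, ← anchor_apply, ← anchor_apply, key hA hB, key hB hA, pullbackBr]
  noncomm_ring

theorem pullbackBr_add_right (ht : ∀ K, ∀ A ∈ E K, anchor F K A ∈ tangent K)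
    {A B C : Tw V → (V →L[ℝ] V)} (hA : A ∈ Gam E) (hB : B ∈ Gam E) (hC : C ∈ Gam E) (K : Tw V) :
    pullbackBr F D A (B + C) K = pullbackBr F D A B K + pullbackBr F D A C K := by
  have h : dd (B + C) K (anchor F K (A K)) =
      dd B K (anchor F K (A K)) + dd C K (anchor F K (A K)) :=
    dd_add hB.1 hC.1 (ht K _ (hA.2 K))
  simp only [pullbackBr, h, Pi.add_apply, map_add, dd_add_right]
  noncomm_ring

theorem pullbackBr_smul_right (ht : ∀ K, ∀ A ∈ E K, anchor F K A ∈ tangent K)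
    {A B : Tw V → (V →L[ℝ] V)} (hA : A ∈ Gam E) (hB : B ∈ Gam E) {f : Tw V → ℝ}
    (hf : IsSmooth f) (K : Tw V) :
    pullbackBr F D A (fun K => f K • B K) K =
      f K • pullbackBr F D A B K + dd f K (anchor F K (A K)) • B K := by
  simp only [pullbackBr, dd_smul hf hB.1 (ht K _ (hA.2 K)), map_smul, dd_smul_right,
    mul_smul_comm, smul_mul_assoc]
  module

theorem isSmooth_pullbackBr (ht : ∀ K, ∀ A ∈ E K, anchor F K A ∈ tangent K) (hF : IsSmooth F)
    (hD : ∀ A : Tw V → (V →L[ℝ] V), IsSmooth A → IsSmooth fun K => D K (A K))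
    {A B : Tw V → (V →L[ℝ] V)} (hA : A ∈ Gam E) (hB : B ∈ Gam E) :
    IsSmooth (pullbackBr F D A B) := by
  have h1 : ∀ {A B : Tw V → (V →L[ℝ] V)}, A ∈ Gam E → B ∈ Gam E →
      IsSmooth fun K => dd B K (anchor F K (A K)) := fun hA hB =>
    hB.1.dd (isSmooth_anchor hF hA.1) (fun K => ht K _ (hA.2 K))
  have h2 : ∀ {A B : Tw V → (V →L[ℝ] V)}, A ∈ Gam E → B ∈ Gam E →
      IsSmooth fun K => D K (A K) * F K * B K + B K * F K * D K (A K) := fun hA hB =>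
    (((hD _ hA.1).mul hF).mul hB.1).add ((hB.1.mul hF).mul (hD _ hA.1))
  have h3 : ∀ {A B : Tw V → (V →L[ℝ] V)}, A ∈ Gam E → B ∈ Gam E →
      IsSmooth fun K => A K * F K * F K * B K := fun hA hB =>
    ((hA.1.mul hF).mul hF).mul hB.1
  exact ((((h1 hA hB).sub (h1 hB hA)).add (h2 hA hB)).sub (h2 hB hA)).sub
    ((h3 hA hB).sub (h3 hB hA))

/-- A bundle with a smooth projection `P` is a skew algebroid with anchor `A ↦ [F A F, φ]`, when
`F` is adapted and `P` does not change the anchor of pulled back brackets. -/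
theorem exists_isSkewAlgebroid [FiniteDimensional ℝ V] (hP : IsBundleProj E P)
    (hFA : IsAdapted E F F) (hE : ∀ K, ∀ A ∈ E K, F K * A * F K ∈ skewEnd V)
    (hPF : ∀ A ∈ Gam E, ∀ B ∈ Gam E, ∀ K C,
      F K * C * F K = actionBr (fun K => F K * A K * F K) (fun K => F K * B K * F K) K →
        anchor F K (P K C) = anchor F K C) :
    ∃ br : Gam E →ₗ[ℝ] Gam E →ₗ[ℝ] Gam E, IsSkewAlgebroid E br (anchor F) := by
  obtain ⟨D, hDs, hD⟩ := hFA.deriv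
  have hF := hFA.smooth
  have ht : ∀ K, ∀ A ∈ E K, anchor F K A ∈ tangent K := fun K A hA =>
    commutator_mem_tangent (hE K A hA) K
  -- `D` is only constrained through `F D(A) F`, and `E` need not be closed under the bracket, so
  -- the values have to be projected back to `E`.
  let br₀ : Gam E → Gam E → Gam E := fun A B =>
    ⟨fun K => P K (pullbackBr F D A.1 B.1 K),
      hP.smooth.clm_apply (isSmooth_pullbackBr ht hF hDs A.2 B.2), fun K => hP.mem K _⟩
  have hskew : ∀ A B, br₀ A B = -br₀ B A := by
    intro A B
    ext1
    funext K
    change P K _ = -P K _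
    rw [pullbackBr_neg_swap, map_neg]
  have hadd : ∀ A B C, br₀ A (B + C) = br₀ A B + br₀ A C := by
    intro A B C
    ext1
    funext K
    change P K (pullbackBr F D A.1 (B.1 + C.1) K) = P K _ + P K _
    rw [pullbackBr_add_right ht A.2 B.2 C.2, map_add]
  have hleib : ∀ (A B : Gam E) (f : Tw V → ℝ) (hf : IsSmooth f) (K : Tw V),
      (br₀ A (mulSec f hf B)).1 K =
        f K • (br₀ A B).1 K + dd f K (anchor F K (A.1 K)) • B.1 K := by
    intro A B f hf K
    change P K (pullbackBr F D A.1 (fun K => f K • B.1 K) K) = f K • P K _ + _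
    -- The Leibniz rule survives the projection because `P` fixes the section `B` in the derivative
    -- term.
    rw [pullbackBr_smul_right ht A.2 B.2 hf, map_add, map_smul, map_smul, hP.fix K _ (B.2.2 K)]
  have hsmul : ∀ (c : ℝ) (A B : Gam E), br₀ A (c • B) = c • br₀ A B := by
    intro c A B
    ext1
    funext K
    have h := hleib A B (fun _ => c) (isSmooth_const c) K
    rw [dd_const c (ht K _ (A.2.2 K)), zero_smul, add_zero] at h
    exact h
  refine ⟨LinearMap.mk₂ ℝ br₀ (fun A B C => ?_) (fun c A B => ?_) hadd hsmul,
    hP.isSubbundle, ht, fun A => isSmooth_anchor hF A.2.1, hskew, fun A B => ?_, hleib⟩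
  · rw [hskew, hadd, neg_add, ← hskew, ← hskew]
  · rw [hskew (c • A) B, hsmul, hskew A B]
    exact (smul_neg c (br₀ B A)).symm
  · funext K
    have h1 := mul_pullbackBr_mul ht hF hD A.2 B.2 K
    change anchor F K (P K (pullbackBr F D A.1 B.1 K)) = _
    rw [hPF A.1 A.2 B.1 B.2 K _ h1, anchor_apply, h1]
    exact (lieBr_commutator ((hF.mul A.2.1).mul hF) ((hF.mul B.2.1).mul hF)
      (fun K => hE K _ (A.2.2 K)) (fun K => hE K _ (B.2.2 K)) K).symm

end Bracket

/-! ### Moving `J`, `φ` and the projections past `F = QS` -/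

section Operators

variable {V : Type*} [NormedAddCommGroup V] [InnerProductSpace ℝ V]

/-- Both products equal `JKJ - K`. So `{J,φ}`, and with it `Q`, commutes with everything generated
by `J` and `φ`. -/
theorem commute_anticomm_left (J K : Tw V) : Commute J.1 (J.1 * K.1 + K.1 * J.1) := by
  change J.1 * (J.1 * K.1 + K.1 * J.1) = (J.1 * K.1 + K.1 * J.1) * J.1
  simp only [mul_add, add_mul, J.mul_self_mul, mul_assoc, J.mul_self, mul_neg, mul_one]
  abel

theorem commute_anticomm_right (J K : Tw V) : Commute K.1 (J.1 * K.1 + K.1 * J.1) := by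
  rw [add_comm]
  exact commute_anticomm_left K J

theorem Gen.commute_polyQ (γ : Gen) (J : Tw V) {k : ℕ} (a : Fin (k + 1) → Tw V → ℝ) (K : Tw V) :
    Commute (γ.sec J K) (polyQ J a K) := by
  have h : Commute (γ.sec J K) (J.1 * K.1 + K.1 * J.1) := by
    cases γ
    · exact commute_anticomm_left J K
    · exact (commute_anticomm_left J K).neg_left
    · exact commute_anticomm_right J K
    · exact (commute_anticomm_right J K).neg_left
  exact Commute.sum_right _ _ _ fun i _ => (h.pow_right _).smul_right _

theorem SType.commute_polyQ (S : SType) (J : Tw V) {k : ℕ} (a : Fin (k + 1) → Tw V → ℝ)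
    (K : Tw V) : Commute (S.sec J K) (polyQ J a K) := by
  have hJ : Commute J.1 (polyQ J a K) := Gen.commute_polyQ .posJ J a K
  have hK : Commute K.1 (polyQ J a K) := Gen.commute_polyQ .posPhi J a K
  cases S
  · exact Commute.one_left _
  · exact hJ.add_left hK
  · exact hJ.sub_left hK
  · exact (hJ.mul_left hK).sub_left (hK.mul_left hJ)

theorem Gen.mul_polyQ_mul_S (γ : Gen) (S : SType) (J : Tw V) {k : ℕ}
    (a : Fin (k + 1) → Tw V → ℝ) (K : Tw V) :
    γ.sec J K * (polyQ J a K * S.sec J K) =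
      polyQ J a K * S.sec J K * (γ.tilde S).sec J K := by
  rw [← mul_assoc, (γ.commute_polyQ J a K).eq, mul_assoc, Gen.mul_S, mul_assoc]

theorem Gen.polyQ_mul_S_mul (γ : Gen) (S : SType) (J : Tw V) {k : ℕ}
    (a : Fin (k + 1) → Tw V → ℝ) (K : Tw V) :
    polyQ J a K * S.sec J K * γ.sec J K =
      (γ.tilde S).sec J K * (polyQ J a K * S.sec J K) := by
  rw [mul_assoc, Gen.S_mul, ← mul_assoc, ← ((γ.tilde S).commute_polyQ J a K).eq, mul_assoc]

theorem Gen.tilde_neg (S : SType) (J K : Tw V) :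
    (Gen.negPhi.tilde S).sec J K = (-1 : ℝ) • (Gen.posPhi.tilde S).sec J K := by
  cases S <;> simp [Gen.tilde, Gen.sec]

theorem isSmooth_polyQ (J : Tw V) {k : ℕ} {a : Fin (k + 1) → Tw V → ℝ}
    (ha : ∀ i, IsSmooth (a i)) : IsSmooth (polyQ J a) := by
  have hp : ∀ n : ℕ, IsSmooth fun K : Tw V => (J.1 * K.1 + K.1 * J.1) ^ n := by
    intro n
    induction n with
    | zero => simpa using isSmooth_const (V := V) (1 : V →L[ℝ] V)
    | succ n ih =>
      simp only [pow_succ]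
      exact ih.mul (((isSmooth_const J.1).mul isSmooth_val).add
        (isSmooth_val.mul (isSmooth_const J.1)))
  have hs : ∀ s : Finset (Fin (k + 1)),
      IsSmooth fun K : Tw V => ∑ i ∈ s, a i K • (J.1 * K.1 + K.1 * J.1) ^ (i : ℕ) := by
    intro s
    classical
    induction s using Finset.induction_on with
    | empty => simpa using isSmooth_const (V := V) (0 : V →L[ℝ] V)
    | insert i s hi ih =>
      simp only [Finset.sum_insert hi]
      exact ((ha i).smul (hp _)).add ih
  exact hs Finset.univ

variable [CompleteSpace V]

theorem star_polyQ (J : Tw V) {k : ℕ} (a : Fin (k + 1) → Tw V → ℝ) (K : Tw V) :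
    star (polyQ J a K) = polyQ J a K := by
  simp only [polyQ, star_sum, star_smul, star_pow, star_add, star_mul, J.star_eq, K.star_eq,
    star_trivial, neg_mul_neg]
  simp only [add_comm]

theorem SType.star_eq (S : SType) (J K : Tw V) :
    star (S.sec J K) = S.sec J K ∨ star (S.sec J K) = -S.sec J K := by
  cases S
  · exact Or.inl (star_one _)
  · exact Or.inr (by simp [SType.sec, Tw.star_eq]; abel)
  · exact Or.inr (by simp [SType.sec, Tw.star_eq]; abel)
  · exact Or.inr (by simp [SType.sec, Tw.star_eq])

theorem star_polyQ_mul_S (S : SType) (J : Tw V) {k : ℕ} (a : Fin (k + 1) → Tw V → ℝ) (K : Tw V) :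
    star (polyQ J a K * S.sec J K) = polyQ J a K * S.sec J K ∨
      star (polyQ J a K * S.sec J K) = -(polyQ J a K * S.sec J K) := by
  rw [star_mul, star_polyQ]
  refine (S.star_eq J K).imp (fun h => ?_) fun h => ?_
  · rw [h, (S.commute_polyQ J a K).eq]
  · rw [h, neg_mul, (S.commute_polyQ J a K).eq]

/-- The sign is irrelevant because `F` occurs twice; hence `A ↦ FAF` preserves skewness whether `F`
is symmetric or skew. -/
theorem star_conj {F : V →L[ℝ] V} (hF : star F = F ∨ star F = -F) (A : V →L[ℝ] V) :
    star (F * A * F) = F * star A * F := by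
  rcases hF with h | h <;> simp [h, mul_assoc]

theorem conj_mem_skewEnd {F A : V →L[ℝ] V} (hF : star F = F ∨ star F = -F)
    (hA : A ∈ skewEnd V) : F * A * F ∈ skewEnd V := by
  rw [mem_skewEnd_iff, star_conj hF, mem_skewEnd_iff.1 hA, mul_neg, neg_mul]

theorem conj_skewProj {F : V →L[ℝ] V} (hF : star F = F ∨ star F = -F) (C : V →L[ℝ] V) :
    F * skewProj V C * F = skewProj V (F * C * F) := by
  simp only [skewProj_apply, star_conj hF, mul_smul_comm, smul_mul_assoc, mul_sub, sub_mul]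

/-- Since `Fη' = ηF` and `η'F = Fη`, one has `F(η'Cη')F = η(FCF)η`. This turns the projection onto
`E^S` into the one onto `E`. -/
theorem conj_genProj {F η η' : V →L[ℝ] V} (hF : star F = F ∨ star F = -F) (σ : ℝ)
    (hl : η * F = F * η') (hr : F * η = η' * F) (C : V →L[ℝ] V) :
    F * genProj σ η' C * F = genProj σ η (F * C * F) := by
  simp only [genProj_apply, ← conj_skewProj hF, mul_smul_comm, smul_mul_assoc, mul_sub, sub_mul]
  congr 3
  simp only [mul_assoc]
  rw [← hr, ← mul_assoc F η', ← hl, mul_assoc]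

end Operators

/-! ### Behaviour of the action bracket on the bundles `E` -/

section ActionBracket

variable {V : Type*} [NormedAddCommGroup V] [InnerProductSpace ℝ V] [CompleteSpace V]
variable {A B : Tw V → (V →L[ℝ] V)}

theorem dd_mem_skewEnd (hA : IsSmooth A) (hA' : ∀ K, A K ∈ skewEnd V) {K : Tw V}
    {X : V →L[ℝ] V} (hX : X ∈ tangent K) : dd A K X ∈ skewEnd V := by
  have h := dd_clm_comp hA
    (starL' ℝ : (V →L[ℝ] V) ≃L[ℝ] (V →L[ℝ] V)).toContinuousLinearMap hX
  have h1 : (fun L => (starL' ℝ : (V →L[ℝ] V) ≃L[ℝ] (V →L[ℝ] V)).toContinuousLinearMap (A L)) =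
      fun L => -A L := funext fun L => mem_skewEnd_iff.1 (hA' L)
  rw [h1, dd_neg hA hX] at h
  exact mem_skewEnd_iff.2 h.symm

theorem actionBr_mem_skewEnd (hA : IsSmooth A) (hB : IsSmooth B) (hA' : ∀ K, A K ∈ skewEnd V)
    (hB' : ∀ K, B K ∈ skewEnd V) (K : Tw V) : actionBr A B K ∈ skewEnd V := by
  refine sub_mem (sub_mem (dd_mem_skewEnd hB hB' (commutator_mem_tangent (hA' K) K))
    (dd_mem_skewEnd hA hA' (commutator_mem_tangent (hB' K) K))) ?_
  rw [mem_skewEnd_iff]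
  simp [mem_skewEnd_iff.1 (hA' K), mem_skewEnd_iff.1 (hB' K)]

/-- As `J` is constant, differentiating `JA = AJ` shows that the derivatives of such sections again
commute with `J`. -/
theorem actionBr_mem_uJ (J : Tw V) (hA : A ∈ Gam (genBundle J .posJ .posJ))
    (hB : B ∈ Gam (genBundle J .posJ .posJ)) (K : Tw V) :
    actionBr A B K ∈ genBundle J .posJ .posJ K := by
  refine ⟨actionBr_mem_skewEnd hA.1 hB.1 (fun K => (hA.2 K).1) (fun K => (hB.2 K).1) K, ?_⟩
  have key : ∀ {C : Tw V → (V →L[ℝ] V)} {X : V →L[ℝ] V}, C ∈ Gam (genBundle J .posJ .posJ) →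
      X ∈ tangent K → Commute J.1 (dd C K X) := by
    intro C X hC hX
    have h1 : (fun L : Tw V => J.1 * C L) = fun L => C L * J.1 := funext fun L => (hC.2 L).2
    have h2 := congrArg (fun f => dd f K X) h1
    simp only [dd_mul (isSmooth_const J.1) hC.1 hX, dd_mul hC.1 (isSmooth_const J.1) hX,
      dd_const J.1 hX, zero_mul, mul_zero, zero_add, add_zero] at h2
    exact h2
  have hAK : Commute J.1 (A K) := (hA.2 K).2
  have hBK : Commute J.1 (B K) := (hB.2 K).2
  exact (((key hB (commutator_mem_tangent (hA.2 K).1 K)).sub_right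
    (key hA (commutator_mem_tangent (hB.2 K).1 K))).sub_right
      ((hAK.mul_right hBK).sub_right (hBK.mul_right hAK))).eq

/-- The anchor `[A,φ]` vanishes on `𝔲(φ)`, so `actionBr` reduces to the pointwise `-[A,B]`. -/
theorem actionBr_mem_uPhi (J : Tw V) (hA : A ∈ Gam (genBundle J .posPhi .posPhi))
    (hB : B ∈ Gam (genBundle J .posPhi .posPhi)) (K : Tw V) :
    actionBr A B K ∈ genBundle J .posPhi .posPhi K := by
  refine ⟨actionBr_mem_skewEnd hA.1 hB.1 (fun K => (hA.2 K).1) (fun K => (hB.2 K).1) K, ?_⟩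
  have hAK : Commute K.1 (A K) := (hA.2 K).2
  have hBK : Commute K.1 (B K) := (hB.2 K).2
  have h0 : ∀ C : Tw V → (V →L[ℝ] V), dd C K 0 = 0 := fun C => map_zero _
  rw [actionBr, ← hAK.eq, ← hBK.eq, sub_self, sub_self, h0, h0]
  exact (((Commute.zero_right K.1).sub_right (Commute.zero_right K.1)).sub_right
    ((hAK.mul_right hBK).sub_right (hBK.mul_right hAK))).eq

/-- The removed part `(C - KCK)/2` commutes with `K`. -/
theorem commutator_genProj_neg_one {C : V →L[ℝ] V} (hC : C ∈ skewEnd V) (K : Tw V) :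
    genProj (-1) K.1 C * K.1 - K.1 * genProj (-1) K.1 C = C * K.1 - K.1 * C := by
  rw [genProj_apply, skewProj_of_mem hC]
  simp only [smul_mul_assoc, mul_smul_comm, sub_mul, mul_sub, mul_assoc, K.mul_self,
    K.mul_self_mul, mul_neg, mul_one]
  module

end ActionBracket

/-! ### Assembly for `F = QS` -/

section Main

variable {V : Type*} [NormedAddCommGroup V] [InnerProductSpace ℝ V]

/-- The hypothesis on the coefficients, for the anchor of `F = Q S` instead of that of `S`. -/
theorem dd_coeff_eq_zero {E : Tw V → Submodule ℝ (V →L[ℝ] V)}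
    {P : Tw V → (V →L[ℝ] V) →L[ℝ] (V →L[ℝ] V)} (hP : IsBundleProj E P) (J : Tw V) (S : SType)
    {k : ℕ} {a : Fin (k + 1) → Tw V → ℝ} (ha : ∀ i, IsSmooth (a i))
    (hQ : ∀ K, ∀ A ∈ E K, polyQ J a K * A * polyQ J a K ∈ E K)
    (hda : ∀ i, ∀ C ∈ Gam E, ∀ K, dd (a i) K (anchor (S.sec J) K (C K)) = 0)
    (i : Fin (k + 1)) (K : Tw V) {A : V →L[ℝ] V} (hA : A ∈ E K) :
    dd (a i) K (anchor (fun K => polyQ J a K * S.sec J K) K A) = 0 := by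
  have hQs := isSmooth_polyQ J ha
  -- The vector `A` is extended to the section `P L A` and conjugated by `Q`: since `Q` commutes
  -- with `S`, `FAF = S(QAQ)S`.
  have h := hda i (fun L => polyQ J a L * P L A * polyQ J a L)
    ⟨(hQs.mul (hP.smooth.clm_apply (isSmooth_const A))).mul hQs,
      fun L => hQ L _ (hP.mem L A)⟩ K
  have h1 : polyQ J a K * S.sec J K * A * (polyQ J a K * S.sec J K) =
      S.sec J K * (polyQ J a K * A * polyQ J a K) * S.sec J K := by
    rw [← (S.commute_polyQ J a K).eq]
    simp only [mul_assoc]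
    rw [(S.commute_polyQ J a K).eq]
  simp only [hP.fix K A hA] at h
  rw [anchor_apply] at h
  rw [anchor_apply, h1]
  exact h

variable [CompleteSpace V]

theorem isAdapted_polyQ_mul_S {E : Tw V → Submodule ℝ (V →L[ℝ] V)} (J : Tw V) (S : SType) {k : ℕ}
    {a : Fin (k + 1) → Tw V → ℝ} (ha : ∀ i, IsSmooth (a i))
    (ht : ∀ K, ∀ A ∈ E K, anchor (fun K => polyQ J a K * S.sec J K) K A ∈ tangent K)
    (hda : ∀ i K, ∀ A ∈ E K, dd (a i) K (anchor (fun K => polyQ J a K * S.sec J K) K A) = 0) :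
    IsAdapted E (fun K => polyQ J a K * S.sec J K) (fun K => polyQ J a K * S.sec J K) := by
  have hJ : IsAdapted E (fun K => polyQ J a K * S.sec J K) (fun _ => J.1) :=
    isAdapted_const ht J.1 ((Gen.posJ.tilde S).isSmooth J)
      (fun K => Gen.mul_polyQ_mul_S .posJ S J a K) (fun K => Gen.polyQ_mul_S_mul .posJ S J a K)
  have hK : IsAdapted E (fun K => polyQ J a K * S.sec J K) (fun K => K.1) :=
    isAdapted_val ht ((Gen.posPhi.tilde S).isSmooth J)
      (fun K => Gen.mul_polyQ_mul_S .posPhi S J a K)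
      (fun K => Gen.polyQ_mul_S_mul .posPhi S J a K)
  have hS : IsAdapted E (fun K => polyQ J a K * S.sec J K) (S.sec J) := by
    cases S
    · exact isAdapted_one ht
    · exact hJ.add ht hK
    · have h := hJ.add ht (hK.neg ht)
      simp only [← sub_eq_add_neg] at h
      exact h
    · have h := (hJ.mul ht hK).add ht ((hK.mul ht hJ).neg ht)
      simp only [← sub_eq_add_neg] at h
      exact h
  refine IsAdapted.mul ht (isAdapted_sum ht Finset.univ fun i => ?_) hS
  have h := (isAdapted_smul_one ht (ha i) (hda i)).mul ht
    (((hJ.mul ht hK).add ht (hK.mul ht hJ)).pow ht (i : ℕ))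
  simpa only [smul_one_mul] using h

theorem polyQ_conj_mem_genBundle (J : Tw V) {γ δ : Gen} {k : ℕ} (a : Fin (k + 1) → Tw V → ℝ)
    (K : Tw V) {A : V →L[ℝ] V} (hA : A ∈ genBundle J γ δ K) :
    polyQ J a K * A * polyQ J a K ∈ genBundle J γ δ K := by
  refine ⟨conj_mem_skewEnd (Or.inl (star_polyQ J a K)) hA.1, ?_⟩
  have hA' := hA.2
  rw [mul_assoc _ _ (δ.sec J K), ← (δ.commute_polyQ J a K).eq, ← mul_assoc, ← mul_assoc,
    (γ.commute_polyQ J a K).eq, mul_assoc _ _ A, hA']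
  simp only [mul_assoc]

/-- This is the reason for the definition of `E^S`: `γFAF = Fγ̃AF = FAδ̃F = FAFδ`. -/
theorem conj_mem_genBundle (J : Tw V) (S : SType) {γ δ : Gen} {k : ℕ}
    (a : Fin (k + 1) → Tw V → ℝ) (K : Tw V) {A : V →L[ℝ] V}
    (hA : A ∈ genBundle J (γ.tilde S) (δ.tilde S) K) :
    polyQ J a K * S.sec J K * A * (polyQ J a K * S.sec J K) ∈ genBundle J γ δ K := by
  refine ⟨conj_mem_skewEnd (star_polyQ_mul_S S J a K) hA.1, ?_⟩
  have hA' := hA.2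
  rw [mul_assoc _ _ (δ.sec J K), δ.polyQ_mul_S_mul, ← mul_assoc (γ.sec J K),
    ← mul_assoc (γ.sec J K), γ.mul_polyQ_mul_S, mul_assoc _ _ A, hA']
  simp only [mul_assoc]

variable [FiniteDimensional ℝ V]

theorem exists_isSkewAlgebroid_skewEnd (J : Tw V) (S : SType) {k : ℕ}
    {a : Fin (k + 1) → Tw V → ℝ} (ha : ∀ i, IsSmooth (a i))
    (hda : ∀ i, ∀ C ∈ Gam (fun _ : Tw V => skewEnd V), ∀ K,
      dd (a i) K (anchor (S.sec J) K (C K)) = 0) :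
    ∃ br : Gam (fun _ : Tw V => skewEnd V) →ₗ[ℝ] Gam (fun _ : Tw V => skewEnd V) →ₗ[ℝ]
        Gam (fun _ : Tw V => skewEnd V),
      IsSkewAlgebroid (fun _ : Tw V => skewEnd V) br
        (anchor fun K => polyQ J a K * S.sec J K) := by
  have hE : ∀ K : Tw V, ∀ A ∈ skewEnd V,
      polyQ J a K * S.sec J K * A * (polyQ J a K * S.sec J K) ∈ skewEnd V := fun K A hA =>
    conj_mem_skewEnd (star_polyQ_mul_S S J a K) hA
  have hF := isAdapted_polyQ_mul_S (E := fun _ => skewEnd V) J S ha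
    (fun K A hA => commutator_mem_tangent (hE K A hA) K) fun i K A hA =>
      dd_coeff_eq_zero isBundleProj_skew J S ha
        (fun K A hA => conj_mem_skewEnd (Or.inl (star_polyQ J a K)) hA) hda i K hA
  refine exists_isSkewAlgebroid isBundleProj_skew hF hE fun A hA B hB K C hC => ?_
  simp only [anchor_apply]
  rw [conj_skewProj (star_polyQ_mul_S S J a K), hC, skewProj_of_mem]
  exact actionBr_mem_skewEnd ((hF.smooth.mul hA.1).mul hF.smooth)
    ((hF.smooth.mul hB.1).mul hF.smooth) (fun K => hE K _ (hA.2 K)) (fun K => hE K _ (hB.2 K)) K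

/-- The sign `σ` encodes `δ = ±γ`. The hypothesis `hC` isolates the only input that depends on `E`:
projecting `actionBr` of two sections of `E` onto `E` must leave the commutator with `φ` unchanged.
-/
theorem exists_isSkewAlgebroid_genBundle (J : Tw V) (S : SType) {γ δ : Gen} {σ : ℝ}
    (hσ : σ * σ = 1) (hδ : ∀ K, (δ.tilde S).sec J K = σ • (γ.tilde S).sec J K)
    (hC : ∀ A ∈ Gam (genBundle J γ δ), ∀ B ∈ Gam (genBundle J γ δ), ∀ K : Tw V,
      genProj σ (γ.sec J K) (actionBr A B K) * K.1 - K.1 * genProj σ (γ.sec J K) (actionBr A B K) =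
        actionBr A B K * K.1 - K.1 * actionBr A B K)
    {k : ℕ} {a : Fin (k + 1) → Tw V → ℝ} (ha : ∀ i, IsSmooth (a i))
    (hda : ∀ i, ∀ C ∈ Gam (genBundle J (γ.tilde S) (δ.tilde S)), ∀ K,
      dd (a i) K (anchor (S.sec J) K (C K)) = 0) :
    ∃ br : Gam (genBundle J (γ.tilde S) (δ.tilde S)) →ₗ[ℝ]
        Gam (genBundle J (γ.tilde S) (δ.tilde S)) →ₗ[ℝ]
        Gam (genBundle J (γ.tilde S) (δ.tilde S)),
      IsSkewAlgebroid (genBundle J (γ.tilde S) (δ.tilde S)) br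
        (anchor fun K => polyQ J a K * S.sec J K) := by
  have hE : ∀ K : Tw V, ∀ A ∈ genBundle J (γ.tilde S) (δ.tilde S) K,
      polyQ J a K * S.sec J K * A * (polyQ J a K * S.sec J K) ∈ genBundle J γ δ K := fun K A hA =>
    conj_mem_genBundle J S a K hA
  have hP := isBundleProj_gen J hσ hδ
  have hF := isAdapted_polyQ_mul_S (E := genBundle J (γ.tilde S) (δ.tilde S)) J S ha
    (fun K A hA => commutator_mem_tangent (hE K A hA).1 K) fun i K A hA =>
      dd_coeff_eq_zero hP J S ha (fun K A hA => polyQ_conj_mem_genBundle J a K hA) hda i K hA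
  refine exists_isSkewAlgebroid hP hF (fun K A hA => (hE K A hA).1) fun A hA B hB K C hCK => ?_
  simp only [anchor_apply]
  rw [conj_genProj (star_polyQ_mul_S S J a K) σ (γ.mul_polyQ_mul_S S J a K)
    (γ.polyQ_mul_S_mul S J a K), hCK]
  exact hC _ ⟨(hF.smooth.mul hA.1).mul hF.smooth, fun K => hE K _ (hA.2 K)⟩
    _ ⟨(hF.smooth.mul hB.1).mul hF.smooth, fun K => hE K _ (hB.2 K)⟩ K

end Main

end Twistor

end

theorem theorem4p2 {V : Type*} [NormedAddCommGroup V] [InnerProductSpace ℝ V]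
    [FiniteDimensional ℝ V] (hdim : 4 ≤ Module.finrank ℝ V)
    (J : Twistor.Tw V) (S : Twistor.SType) (E : Twistor.EType)
    (k : ℕ) (a : Fin (k + 1) → Twistor.Tw V → ℝ) (ha : ∀ i, Twistor.IsSmooth (a i))
    (hda : ∀ i, ∀ C ∈ Twistor.Gam (E.bundleS S J), ∀ K : Twistor.Tw V,
      Twistor.dd (a i) K (Twistor.anchor (S.sec J) K (C K)) = 0) :
    ∃ br : Twistor.Gam (E.bundleS S J) →ₗ[ℝ] Twistor.Gam (E.bundleS S J) →ₗ[ℝ]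
        Twistor.Gam (E.bundleS S J),
      Twistor.IsSkewAlgebroid (E.bundleS S J) br
        (Twistor.anchor fun K => Twistor.polyQ J a K * S.sec J K) := by
  have : CompleteSpace V := FiniteDimensional.complete ℝ V
  cases E
  · exact Twistor.exists_isSkewAlgebroid_skewEnd J S ha hda
  -- `𝔬_{φ}` is not closed under `actionBr`: the part of the bracket commuting with `φ` is `[A,B]`.
  -- The anchor does not see that part.
  · refine Twistor.exists_isSkewAlgebroid_genBundle J S (γ := .posPhi) (δ := .negPhi) (σ := -1)
      (by norm_num) (Twistor.Gen.tilde_neg S J) (fun A hA B hB K => ?_) ha hda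
    exact Twistor.commutator_genProj_neg_one (Twistor.actionBr_mem_skewEnd hA.1 hB.1
      (fun K => (hA.2 K).1) (fun K => (hB.2 K).1) K) K
  · refine Twistor.exists_isSkewAlgebroid_genBundle J S (γ := .posJ) (δ := .posJ) (σ := 1)
      (by norm_num) (fun K => (one_smul ℝ _).symm) (fun A hA B hB K => ?_) ha hda
    -- Here the bracket already lies in `E`, so the projection fixes it.
    rw [(Twistor.isBundleProj_gen J (mul_one 1) fun K => (one_smul ℝ _).symm).fix K _
      (Twistor.actionBr_mem_uJ J hA hB K)]
  · refine Twistor.exists_isSkewAlgebroid_genBundle J S (γ := .posPhi) (δ := .posPhi) (σ := 1)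
      (by norm_num) (fun K => (one_smul ℝ _).symm) (fun A hA B hB K => ?_) ha hda
    rw [(Twistor.isBundleProj_gen J (mul_one 1) fun K => (one_smul ℝ _).symm).fix K _
      (Twistor.actionBr_mem_uPhi J hA hB K)]
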